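/- Let $\mathfrak H$, $\mathfrak T$, $\mathcal H$ be complex Hilbert spaces, $A$ a densely defined symmetric operator in $\mathfrak H$, and $\Pi_A=\{\mathcal H,\Gamma_0,\Gamma_1\}$ a boundary triplet for $A^*$; that is, $\Gamma_0,\Gamma_1:\operatorname{dom}(A^*)\to\mathcal H$ are linear, $$(A^*f,g)-(f,A^*g)=(\Gamma_1f,\Gamma_0g)-(\Gamma_0f,\Gamma_1g)\qquad(f,g\in\operatorname{dom}(A^*)),$$ and $f\mapsto(\Gamma_0f,\Gamma_1f)$ maps $\operatorname{dom}(A^*)$ onto $\mathcal H\oplus\mathcal H$. Put $A_0:=A^*\upharpoonright\ker\Gamma_0$, $\mathfrak N_z(A^*):=\ker(A^*-z)$, and for $z\in\mathbb C_\pm=\mathbb C\setminus\mathbb R$ let $$\gamma^A(z):=(\Gamma_0\upharpoonright\mathfrak N_z(A^*))^{-1}\in\mathcal B(\mathcal H,\mathfrak H),\qquad M^A(z):=\Gamma_1\gamma^A(z)\in\mathcal B(\mathcal H)$$ be the $\gamma$-field and the Weyl function of $\Pi_A$. The same notation is used for other boundary triplets. Let $T=T^*\in\mathcal B(\mathfrak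 T)$ with spectral measure $E_T$, let $\Delta=[a,b]$ be the smallest closed interval containing $\sigma(T)$, and put $\widehat E_T(\delta):=I_{\mathcal H}\otimes E_T(\delta)$. For an operator $B$ in $\mathfrak H$, $B\otimes I_{\mathfrak T}+I_{\mathfrak H}\otimes T$ denotes the closure, in the Hilbert space tensor product $\mathfrak H\otimes\mathfrak T$, of the operator that is defined on the span of all $g\otimes h$ with $g\in\operatorname{dom}(B)$, $h\in\mathfrak T$, by $g\otimes h\mapsto Bg\otimes h+g\otimes Th$. Put $S:=A\otimes I_{\mathfrak T}+I_{\mathfrak H}\otimes T$. Let $\mathfrak H_+(A^*)$ be $\operatorname{dom}(A^*)$ with the graph norm $(\|f\|^2+\|A^*f\|^2)^{1/2}$, let $J:\mathfrak H_+(A^*)\to\mathfrak H$ be the embedding, and let $\widehat\Gamma_j:\mathfrak H_+(A^*)\to\mathcal H$ be $\Gamma_j$ regarded as a (bounded) operator on $\mathfrak H_+(A^*)$. Define $\Gamma_j\,\widehat\otimes\,I_{\mathfrak T}:=(\widehat\Gamma_j\otimes I_{\mathfrak T})(J\otimes I_{\mathfrak T})^{-1}$ on $\operatorname{ran}(J\otimes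 I_{\mathfrak T})\subseteq\mathfrak H\otimes\mathfrak T$, for $j=0,1$. The operator spectral integral $\int_\Delta\Omega(\lambda)\,F(d\lambda)$ is the limit in operator norm, as the mesh tends to $0$, of the sums $\sum_i\Omega(x_i)F(\Delta_i)$ with $x_i\in\Delta_i$, over the partitions of $[a,b]$ into consecutive intervals $\Delta_i$ that contain their left but not their right endpoint, except that the last one is closed and may be a single point. It is said to exist if there is such a limit, independent of the partitions and of the points $x_i$. Similarly, $\int_\Delta F(d\lambda)\,\Omega(\lambda)$ is the limit of the sums $\sum_iF(\Delta_i)\Omega(x_i)$. Then the following holds. (i) $S$ is closed, densely defined and symmetric, and $\Pi_S:=\{\mathcal H\otimes\mathfrak T,\ \Gamma_0\,\widehat\otimes\,I_{\mathfrak T},\ \Gamma_1\,\widehat\otimes\,I_{\mathfrak T}\}$ is a boundary triplet for $S^*$; in particular $\operatorname{ran}(J\otimes I_{\mathfrak T})=\operatorname{dom}(S^*)$. Moreover $$S_0:=S^*\upharpoonright\ker(\Gamma_0\,\widehat\otimes\,I_{\mathfrak T})=A_0\otimes I_{\mathfrak T}+I_{\mathfrak H}\otimes T .$$ (ii) For every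 $z\in\mathbb C_\pm$ the $\gamma$-field $\gamma^S(z)$ and the Weyl function $M^S(z)$ of $\Pi_S$ are well defined, the following integrals exist, and $$\gamma^S(z)=\int_\Delta\bigl(\gamma^A(z-\lambda)\otimes I_{\mathfrak T}\bigr)\widehat E_T(d\lambda),$$ $$M^S(z)=\int_\Delta\widehat E_T(d\lambda)\bigl(M^A(z-\lambda)\otimes I_{\mathfrak T}\bigr)=\int_\Delta\bigl(M^A(z-\lambda)\otimes I_{\mathfrak T}\bigr)\widehat E_T(d\lambda).$$ In particular, $$\operatorname{ran}\left(\int_\Delta\bigl(\gamma^A(z-\lambda)\otimes I_{\mathfrak T}\bigr)\widehat E_T(d\lambda)\right)=\ker(S^*-z).$$ (iii) If $M^A$ is of scalar type, that is, if there is a scalar Nevanlinna function $m^A$ (holomorphic on $\mathbb C_\pm$, with $m^A(\bar z)=\overline{m^A(z)}$ and $\operatorname{Im}m^A(z)/\operatorname{Im}z\ge0$) such that $M^A(z)=m^A(z)I_{\mathcal H}$ for all $z\in\mathbb C_\pm$, then $$M^S(z)=I_{\mathcal H}\otimes m^A(z-T),\qquad z\in\mathbb C_\pm .$$ In particular, if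 the deficiency indices $n_\pm(A)=\dim\ker(A^*\mp i)$ are both equal to $1$, then $M^A$ is of scalar type and this formula holds. -/

import Mathlib

open scoped TensorProduct LinearPMap InnerProductSpace

noncomputable section

namespace TensorTriplet

section TensorProducts

variable {H H' K K' : Type*}
  [NormedAddCommGroup H] [InnerProductSpace ℂ H] [NormedAddCommGroup H'] [InnerProductSpace ℂ H']
  [NormedAddCommGroup K] [InnerProductSpace ℂ K] [NormedAddCommGroup K'] [InnerProductSpace ℂ K']

/-- The Hilbert space tensor product: the completion of the algebraic tensor product with respect
to the inner product `⟪a ⊗ b, c ⊗ d⟫ = ⟪a, c⟫ ⟪b, d⟫`. -/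
abbrev HTensor (H K : Type*) [NormedAddCommGroup H] [InnerProductSpace ℂ H]
    [NormedAddCommGroup K] [InnerProductSpace ℂ K] : Type _ :=
  UniformSpace.Completion (H ⊗[ℂ] K)

/-- The tensor product `X ⊗ Y` of bounded operators, as a bounded operator between the Hilbert
space tensor products. -/
def tensorMap (X : H →L[ℂ] H') (Y : K →L[ℂ] K') : HTensor H K →L[ℂ] HTensor H' K' :=
  (TensorProduct.mapL X Y).completion

/-- The inclusion of the algebraic tensor product `dom B ⊙ K` into the Hilbert space tensor product
of `H` and `K`. -/
def algIncl (B : H →ₗ.[ℂ] H) (K : Type*) [NormedAddCommGroup K] [InnerProductSpace ℂ K] :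
    (B.domain ⊗[ℂ] K) →ₗ[ℂ] HTensor H K :=
  (UniformSpace.Completion.toComplL : (H ⊗[ℂ] K) →L[ℂ] HTensor H K).toLinearMap ∘ₗ
    B.domain.subtype.rTensor K

theorem algIncl_injective (B : H →ₗ.[ℂ] H) : Function.Injective (algIncl B K) := by
  have h1 : Function.Injective (B.domain.subtype.rTensor K) :=
    Module.Flat.rTensor_preserves_injective_linearMap _ B.domain.subtype_injective
  have h2 : Function.Injective ((↑) : H ⊗[ℂ] K → HTensor H K) :=
    UniformSpace.Completion.coe_injective _
  exact h2.comp h1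

/-- The operator `B ⊙ I + I ⊙ T`: its domain is the span of all `g ⊗ h` with `g ∈ dom B`, `h ∈ K`,
and it maps `g ⊗ h` to `B g ⊗ h + g ⊗ T h`. -/
def algTensorSum (B : H →ₗ.[ℂ] H) (T : K →L[ℂ] K) : HTensor H K →ₗ.[ℂ] HTensor H K where
  domain := LinearMap.range (algIncl B K)
  toFun :=
    ((UniformSpace.Completion.toComplL : (H ⊗[ℂ] K) →L[ℂ] HTensor H K).toLinearMap ∘ₗ
      (B.toFun.rTensor K + TensorProduct.map B.domain.subtype T.toLinearMap)) ∘ₗ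
    (LinearEquiv.ofInjective (algIncl B K) (algIncl_injective B)).symm.toLinearMap

/-- The operator `B ⊗ I + I ⊗ T`: the closure of `B ⊙ I + I ⊙ T`. -/
def tensorSum (B : H →ₗ.[ℂ] H) (T : K →L[ℂ] K) : HTensor H K →ₗ.[ℂ] HTensor H K :=
  (algTensorSum B T).closure

end TensorProducts

section GraphSpace

variable {H : Type*} [NormedAddCommGroup H] [InnerProductSpace ℂ H]

/-- The domain of an operator `B` with the graph norm `‖f‖² + ‖B f‖²`, realised as the graph
`{(f, B f)}` of `B` in the Hilbert space direct sum `H ⊕ H`. -/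
def graphSpace (B : H →ₗ.[ℂ] H) : Submodule ℂ (WithLp 2 (H × H)) :=
  B.graph.comap (WithLp.linearEquiv 2 ℂ (H × H)).toLinearMap

/-- The embedding `(f, B f) ↦ f` of the graph space into `H`. -/
def graphEmb (B : H →ₗ.[ℂ] H) : graphSpace B →L[ℂ] H :=
  (WithLp.fstL 2 ℂ H H).comp (graphSpace B).subtypeL

/-- The operator `(f, B f) ↦ B f`. -/
def graphVal (B : H →ₗ.[ℂ] H) : graphSpace B →L[ℂ] H :=
  (WithLp.sndL 2 ℂ H H).comp (graphSpace B).subtypeL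

theorem graphEmb_mem (B : H →ₗ.[ℂ] H) (u : graphSpace B) : graphEmb B u ∈ B.domain :=
  LinearPMap.mem_domain_of_mem_graph u.2

/-- The embedding `(f, B f) ↦ f`, as a linear map onto `dom B`. -/
def graphToDomain (B : H →ₗ.[ℂ] H) : graphSpace B →ₗ[ℂ] B.domain :=
  (graphEmb B).toLinearMap.codRestrict B.domain (graphEmb_mem B)

theorem apply_graphToDomain (B : H →ₗ.[ℂ] H) (u : graphSpace B) :
    B (graphToDomain B u) = graphVal B u :=
  (LinearPMap.mem_graph_iff B).1 u.2 |>.elim fun y hy => by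
    rw [show graphToDomain B u = y from Subtype.ext hy.1.symm]; exact hy.2

theorem graphSpace_complete [CompleteSpace H] {B : H →ₗ.[ℂ] H} (hB : B.IsClosed) :
    CompleteSpace (graphSpace B) := by
  have : IsClosed (graphSpace B : Set (WithLp 2 (H × H))) :=
    IsClosed.preimage (WithLp.prod_continuous_ofLp 2 H H) hB
  exact this.completeSpace_coe

end GraphSpace

section BoundaryTriplets

variable {H G : Type*}
  [NormedAddCommGroup H] [InnerProductSpace ℂ H] [CompleteSpace H]
  [NormedAddCommGroup G] [InnerProductSpace ℂ G]

/-- A boundary triplet `(G, Γ₀, Γ₁)` for the adjoint `A†` of a densely defined symmetric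
operator `A` in `H`. -/
structure BoundaryTriplet (A : H →ₗ.[ℂ] H) (G : Type*) [NormedAddCommGroup G]
    [InnerProductSpace ℂ G] where
  dense_domain : Dense (A.domain : Set H)
  symmetric : A.IsFormalAdjoint A
  Γ₀ : A†.domain →ₗ[ℂ] G
  Γ₁ : A†.domain →ₗ[ℂ] G
  green : ∀ f g : A†.domain,
    ⟪A† f, (g : H)⟫_ℂ - ⟪(f : H), A† g⟫_ℂ = ⟪Γ₁ f, Γ₀ g⟫_ℂ - ⟪Γ₀ f, Γ₁ g⟫_ℂ
  surjective : ∀ u v : G, ∃ f : A†.domain, Γ₀ f = u ∧ Γ₁ f = v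

/-- The defect subspace `ker (A† - z)`, as a subspace of `H`. -/
def defectSpace (A : H →ₗ.[ℂ] H) (z : ℂ) : Submodule ℂ H :=
  (LinearMap.ker (A†.toFun - z • A†.domain.subtype)).map A†.domain.subtype

/-- The defect subspace `ker (A† - z)`, as a subspace of the domain of `A†` with the graph norm. -/
def graphDefectSpace (A : H →ₗ.[ℂ] H) (z : ℂ) : Submodule ℂ (graphSpace A†) :=
  LinearMap.ker (graphVal A† - z • graphEmb A†).toLinearMap

namespace BoundaryTriplet

variable {A : H →ₗ.[ℂ] H} (Bt : BoundaryTriplet A G)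

/-- The boundary map `Γ₀` as an operator in `H` with domain `dom A†`. -/
def Γ₀p : H →ₗ.[ℂ] G := ⟨A†.domain, Bt.Γ₀⟩

/-- The boundary map `Γ₁` as an operator in `H` with domain `dom A†`. -/
def Γ₁p : H →ₗ.[ℂ] G := ⟨A†.domain, Bt.Γ₁⟩

/-- The extension `A₀`: the restriction of `A†` to the kernel of `Γ₀`. -/
def ext₀ : H →ₗ.[ℂ] H := A†.domRestrict ((LinearMap.ker Bt.Γ₀).map A†.domain.subtype)

/-- The boundary maps are bounded for the graph norm. -/
theorem continuous_prod [CompleteSpace G] :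
    Continuous ((Bt.Γ₀.prod Bt.Γ₁).comp (graphToDomain A†)) := by
  have : CompleteSpace (graphSpace A†) :=
    graphSpace_complete (LinearPMap.adjoint_isClosed Bt.dense_domain)
  refine LinearMap.continuous_of_seq_closed_graph _ fun u x y hu hy => ?_
  set L := (Bt.Γ₀.prod Bt.Γ₁).comp (graphToDomain A†) with hL
  have key : ∀ g : A†.domain, ⟪(y - L x).2, Bt.Γ₀ g⟫_ℂ - ⟪(y - L x).1, Bt.Γ₁ g⟫_ℂ = 0 := by
    intro g
    have h0 : Filter.Tendsto (fun n => u n - x) Filter.atTop (nhds 0) := by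
      simpa using hu.sub_const x
    have h1 : Filter.Tendsto (fun n => L (u n - x)) Filter.atTop (nhds (y - L x)) := by
      simpa using hy.sub_const (L x)
    have hE : Filter.Tendsto (fun n => graphEmb A† (u n - x)) Filter.atTop (nhds 0) := by
      have := ((graphEmb A†).continuous.tendsto 0).comp h0
      rwa [map_zero] at this
    have hV : Filter.Tendsto (fun n => graphVal A† (u n - x)) Filter.atTop (nhds 0) := by
      have := ((graphVal A†).continuous.tendsto 0).comp h0
      rwa [map_zero] at this
    have hl : Filter.Tendsto (fun n => ⟪graphVal A† (u n - x), (g : H)⟫_ℂ -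
        ⟪graphEmb A† (u n - x), A† g⟫_ℂ) Filter.atTop (nhds 0) := by
      have := (hV.inner (𝕜 := ℂ) (tendsto_const_nhds (x := (g : H)))).sub
        (hE.inner (𝕜 := ℂ) (tendsto_const_nhds (x := A† g)))
      rwa [inner_zero_left, inner_zero_left, sub_zero] at this
    have hr : Filter.Tendsto (fun n => ⟪(L (u n - x)).2, Bt.Γ₀ g⟫_ℂ -
        ⟪(L (u n - x)).1, Bt.Γ₁ g⟫_ℂ) Filter.atTop
        (nhds (⟪(y - L x).2, Bt.Γ₀ g⟫_ℂ - ⟪(y - L x).1, Bt.Γ₁ g⟫_ℂ)) :=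
      (((continuous_snd.tendsto _).comp h1).inner tendsto_const_nhds).sub
        (((continuous_fst.tendsto _).comp h1).inner tendsto_const_nhds)
    refine tendsto_nhds_unique hr (hl.congr fun n => ?_)
    rw [← apply_graphToDomain]
    exact Bt.green (graphToDomain A† (u n - x)) g
  obtain ⟨g, hg0, hg1⟩ := Bt.surjective (y - L x).2 0
  obtain ⟨k, hk0, hk1⟩ := Bt.surjective 0 (y - L x).1
  have e2 : (y - L x).2 = 0 := by
    have := key g
    rw [hg0, hg1, inner_zero_right, sub_zero] at this
    exact inner_self_eq_zero.1 this
  have e1 : (y - L x).1 = 0 := by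
    have := key k
    rw [hk0, hk1, inner_zero_right, zero_sub, neg_eq_zero] at this
    exact inner_self_eq_zero.1 this
  exact sub_eq_zero.1 (Prod.ext e1 e2)

variable [CompleteSpace G]

/-- The boundary map `Γ₀` as a bounded operator on `dom A†` with the graph norm. -/
def hatΓ₀ : graphSpace A† →L[ℂ] G :=
  ⟨Bt.Γ₀.comp (graphToDomain A†), continuous_fst.comp Bt.continuous_prod⟩

/-- The boundary map `Γ₁` as a bounded operator on `dom A†` with the graph norm. -/
def hatΓ₁ : graphSpace A† →L[ℂ] G :=
  ⟨Bt.Γ₁.comp (graphToDomain A†), continuous_snd.comp Bt.continuous_prod⟩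

/-- The restriction of `Γ₀` to `ker (A† - z)`. On this subspace the graph norm and the norm of `H`
are equivalent. -/
def restrΓ₀ (z : ℂ) : graphDefectSpace A z →L[ℂ] G :=
  Bt.hatΓ₀.comp (graphDefectSpace A z).subtypeL

/-- The inverse of the restriction of `Γ₀` to `ker (A† - z)`, with values in the graph space. -/
def gammaHat (z : ℂ) : G →L[ℂ] graphSpace A† :=
  (graphDefectSpace A z).subtypeL.comp (Bt.restrΓ₀ z).inverse

/-- The `γ`-field `γ(z) = (Γ₀ ↾ ker (A† - z))⁻¹`. -/
def gammaField (z : ℂ) : G →L[ℂ] H := (graphEmb A†).comp (Bt.gammaHat z)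

/-- The Weyl function `M(z) = Γ₁ γ(z)`. -/
def weyl (z : ℂ) : G →L[ℂ] G := Bt.hatΓ₁.comp (Bt.gammaHat z)

/-- For a bounded operator `L` on `dom A†` with the graph norm, the operator `(L ⊗ I) J⁻¹`, where
`J` is the embedding `(dom A†) ⊗ K → H ⊗ K`; its domain is the range of `J`. -/
def tensorBoundary (A : H →ₗ.[ℂ] H) (L : graphSpace A† →L[ℂ] G) (K : Type*) [NormedAddCommGroup K]
    [InnerProductSpace ℂ K] : HTensor H K →ₗ.[ℂ] HTensor G K :=
  (LinearMap.range ((tensorMap (graphEmb A†) (ContinuousLinearMap.id ℂ K)).prod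
    (tensorMap L (ContinuousLinearMap.id ℂ K))).toLinearMap).toLinearPMap

end BoundaryTriplet

/-- A scalar Nevanlinna function. -/
def IsNevanlinna (m : ℂ → ℂ) : Prop :=
  DifferentiableOn ℂ m {z | z.im ≠ 0} ∧
    ∀ z : ℂ, z.im ≠ 0 → m (starRingEnd ℂ z) = starRingEnd ℂ (m z) ∧ 0 ≤ (m z).im / z.im

/-- The Weyl function of `Bt` is of scalar type, with the scalar Nevanlinna function `m`. -/
def BoundaryTriplet.IsScalarType [CompleteSpace G] {A : H →ₗ.[ℂ] H} (Bt : BoundaryTriplet A G)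
    (m : ℂ → ℂ) : Prop :=
  IsNevanlinna m ∧ ∀ z : ℂ, z.im ≠ 0 → Bt.weyl z = m z • ContinuousLinearMap.id ℂ G

end BoundaryTriplets

section SpectralMeasure

variable {K : Type*} [NormedAddCommGroup K] [InnerProductSpace ℂ K] [CompleteSpace K]

/-- The spectral subspace of a bounded self-adjoint operator `T` for an open set `U`: the closed
linear span of the ranges of all `f(T)`, where `f` is continuous with support in `U`. -/
def openSpectralSubspace (T : K →L[ℂ] K) (U : Set ℝ) : Submodule ℂ K :=
  (⨆ f : {f : C(ℝ, ℝ) // tsupport f ⊆ U},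
    LinearMap.range (cfc (f.1 : ℝ → ℝ) T).toLinearMap).topologicalClosure

/-- The spectral subspace of `T` for a Borel set `δ`. By outer regularity of the scalar spectral
measures it is the intersection of the spectral subspaces of all open `U ⊇ δ`. -/
def spectralSubspace (T : K →L[ℂ] K) (δ : Set ℝ) : Submodule ℂ K :=
  ⨅ U : {U : Set ℝ // IsOpen U ∧ δ ⊆ U}, openSpectralSubspace T U.1

theorem isClosed_spectralSubspace (T : K →L[ℂ] K) (δ : Set ℝ) :
    IsClosed (spectralSubspace T δ : Set K) := by
  rw [spectralSubspace, Submodule.coe_iInf]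
  exact isClosed_iInter fun U => Submodule.isClosed_topologicalClosure _

instance (T : K →L[ℂ] K) (δ : Set ℝ) : CompleteSpace (spectralSubspace T δ) :=
  (isClosed_spectralSubspace T δ).completeSpace_coe

/-- The spectral measure `E_T` of a bounded self-adjoint operator `T`, evaluated at a Borel set
`δ`: the orthogonal projection onto the spectral subspace of `T` for `δ`. -/
def spectralMeasure (T : K →L[ℂ] K) (δ : Set ℝ) : K →L[ℂ] K :=
  (spectralSubspace T δ).starProjection

end SpectralMeasure

section SpectralIntegral

/-- A tagged partition of `[a, b]` by points `a = p 0 < p 1 < … < p (n + 1) = b` into the cells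
`[p i, p (i + 1))`, where the last cell `[p n, b]` is closed, with one tag in each cell. (All
cells are non-empty; only the last one may be degenerate, as it has to be when `a = b`.) -/
structure TaggedPartition (a b : ℝ) where
  n : ℕ
  pt : Fin (n + 2) → ℝ
  pt_zero : pt 0 = a
  pt_last : pt (Fin.last (n + 1)) = b
  tag : Fin (n + 1) → ℝ
  tag_mem : ∀ i, tag i ∈ if i = Fin.last n then Set.Icc (pt i.castSucc) (pt i.succ)
    else Set.Ico (pt i.castSucc) (pt i.succ)

namespace TaggedPartition

variable {a b : ℝ} (P : TaggedPartition a b)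

/-- The cells of a tagged partition. -/
def cell (i : Fin (P.n + 1)) : Set ℝ :=
  if i = Fin.last P.n then Set.Icc (P.pt i.castSucc) (P.pt i.succ)
    else Set.Ico (P.pt i.castSucc) (P.pt i.succ)

/-- The mesh of the partition is less than `d`. -/
def MeshLt (d : ℝ) : Prop := ∀ i : Fin (P.n + 1), P.pt i.succ - P.pt i.castSucc < d

end TaggedPartition

variable {X Y : Type*} [NormedAddCommGroup X] [InnerProductSpace ℂ X]
  [NormedAddCommGroup Y] [InnerProductSpace ℂ Y]

/-- The operator spectral integral `∫_{[a,b]} Ω(λ) F(dλ)` exists and equals `L`: the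
Riemann-Stieltjes sums `∑ Ω(x_i) F(Δ_i)` converge to `L` in operator norm as the mesh tends to
zero, whatever the partitions and the tags. -/
def HasSpectralIntegral (Ω : ℝ → X →L[ℂ] Y) (F : Set ℝ → X →L[ℂ] X) (a b : ℝ)
    (L : X →L[ℂ] Y) : Prop :=
  ∀ ε > 0, ∃ d > 0, ∀ P : TaggedPartition a b, P.MeshLt d →
    ‖(∑ i, (Ω (P.tag i)).comp (F (P.cell i))) - L‖ < ε

/-- The operator spectral integral `∫_{[a,b]} F(dλ) Ω(λ)` exists and equals `L`. -/
def HasSpectralIntegralLeft (F : Set ℝ → Y →L[ℂ] Y) (Ω : ℝ → X →L[ℂ] Y) (a b : ℝ)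
    (L : X →L[ℂ] Y) : Prop :=
  ∀ ε > 0, ∃ d > 0, ∀ P : TaggedPartition a b, P.MeshLt d →
    ‖(∑ i, (F (P.cell i)).comp (Ω (P.tag i))) - L‖ < ε

end SpectralIntegral

end TensorTriplet

end

/-!
For an operator `B`, the domain with the graph norm is the graph of `B`, a subspace of the Hilbert
space `H ⊕ H`. Write `S = A ⊗ I + I ⊗ T`.

*The adjoint of `S`.* The graph of `A†` is the orthogonal complement of the rotated graph
`{(-A f, f)}`, and the orthogonal complement of `N ⊗ K` is `Nᗮ ⊗ K`. The bounded shear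
`(x, y) ↦ (x, y - (I ⊗ T) x)` turns the condition that `(x, y)` is in the graph of `S†` into
orthogonality to the rotated graph of `A` tensored with `K`. Hence the graph of `S†` consists of
the pairs `((J ⊗ I) u, (V ⊗ I + J ⊗ T) u)` with `u` in `dom A† ⊗ K`, where `J` and `V` are the
embedding of `dom A†` into `H` and the operator `A†` on it (`mem_graph_adjoint_algTensorSum`). As
`J ⊗ I` is injective, `dom S†` is a copy of `dom A† ⊗ K`, and everything can be computed there.

*The boundary triplet.* Green's identity for `S†` holds on elementary tensors, where the terms
with `T` cancel (`green_tensorMap`), and surjectivity holds because `(Γ₀, Γ₁)` has a bounded right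
inverse, which can be tensored with the identity (`exists_tensorMap_eq`). With a bounded right
inverse of `Γ₀`, the kernel of `Γ₀ ⊗ I` is seen to be the closure of the algebraic tensor product
of `ker Γ₀` with `K`, and this is the formula for `S₀` (`tensorTriplet_ext₀`).

*The spectral integrals.* For every boundary triplet and nonreal `z`, Green's identity gives a
resolvent estimate for `A₀` in the graph norm. It shows that `Γ₀` is invertible on `ker (A† - z)`,
and that a vector `u` for which `(A† - z) u` is small is close, in the graph norm, to `γ(z) Γ₀ u`
(`BoundaryTriplet.norm_sub_gammaHat_le`). This is applied to `S`: a Riemann sum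
`u = ∑ (γ(z - xᵢ) ⊗ E(Δᵢ)) g`, taken in `dom A† ⊗ K`, has `(Γ₀ ⊗ I) u = g` because the `E(Δᵢ)` add
up to the identity, and `(S† - z) u = ∑ (γ(z - xᵢ) ⊗ (T - xᵢ) E(Δᵢ)) g`. The latter sum is
orthogonal, so its norm is at most a constant times the mesh. Therefore the Riemann sums converge
to `γ(z) g` of the tensor triplet in the graph norm, uniformly in `‖g‖ ≤ 1`. Applying `J ⊗ I` and
the bounded operator `Γ₁ ⊗ I` gives the integrals for the `γ`-field and the Weyl function.

*Scalar type.* If `M(z) = m(z) I`, the same orthogonality shows that the Riemann sums for `M`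
converge to `I ⊗ m(z - T)`. If the deficiency indices are one, then the boundary space is a line,
on which every operator is a scalar; that this scalar is a Nevanlinna function follows from
Green's identity.
-/

open scoped TensorProduct LinearPMap InnerProductSpace

namespace TensorTriplet

open scoped ComplexConjugate

/-! ### Tensor products of bounded operators -/

section TensorMap

variable {H H' H'' K K' K'' F : Type*}
  [NormedAddCommGroup H] [InnerProductSpace ℂ H] [NormedAddCommGroup H'] [InnerProductSpace ℂ H']
  [NormedAddCommGroup H''] [InnerProductSpace ℂ H'']
  [NormedAddCommGroup K] [InnerProductSpace ℂ K] [NormedAddCommGroup K'] [InnerProductSpace ℂ K']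
  [NormedAddCommGroup K''] [InnerProductSpace ℂ K'']
  [NormedAddCommGroup F] [InnerProductSpace ℂ F]

/-- The elementary tensor `x ⊗ y` in the Hilbert space tensor product. -/
noncomputable def htmul (x : H) (y : K) : HTensor H K := ((x ⊗ₜ[ℂ] y : H ⊗[ℂ] K) : HTensor H K)

@[simp] theorem tensorMap_htmul (X : H →L[ℂ] H') (Y : K →L[ℂ] K') (x : H) (y : K) :
    tensorMap X Y (htmul x y) = htmul (X x) (Y y) := by
  simp only [tensorMap, htmul, ContinuousLinearMap.completion_apply_coe]
  rfl

theorem inner_htmul (x x' : H) (y y' : K) :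
    ⟪htmul x y, htmul x' y'⟫_ℂ = ⟪x, x'⟫_ℂ * ⟪y, y'⟫_ℂ := by
  simp [htmul]

theorem continuous_htmul : Continuous fun p : H × K => htmul p.1 p.2 :=
  (UniformSpace.Completion.continuous_coe _).comp TensorProduct.continuous_tmul

theorem clm_ext {f g : HTensor H K →L[ℂ] F} (h : ∀ x y, f (htmul x y) = g (htmul x y)) :
    f = g := by
  ext u
  induction u using UniformSpace.Completion.induction_on with
  | hp => exact isClosed_eq f.continuous g.continuous
  | ih a =>
    induction a with
    | zero => rw [UniformSpace.Completion.coe_zero, map_zero, map_zero]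
    | tmul x y => exact h x y
    | add a b ha hb => simp only [UniformSpace.Completion.coe_add, map_add, ha, hb]

/-- The elementary tensors are total. -/
theorem eq_zero_of_inner_htmul {u : HTensor H K} (h : ∀ x y, ⟪u, htmul x y⟫_ℂ = 0) : u = 0 := by
  have : innerSL ℂ u = 0 := clm_ext fun x y => by simpa using h x y
  have h2 := congrArg (fun f => f u) this
  simpa using h2

theorem tensorMap_comp (X' : H' →L[ℂ] H'') (X : H →L[ℂ] H') (Y' : K' →L[ℂ] K'')
    (Y : K →L[ℂ] K') :
    (tensorMap X' Y').comp (tensorMap X Y) = tensorMap (X'.comp X) (Y'.comp Y) :=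
  clm_ext fun x y => by simp

theorem tensorMap_tensorMap (X' : H' →L[ℂ] H'') (X : H →L[ℂ] H') (Y' : K' →L[ℂ] K'')
    (Y : K →L[ℂ] K') (u : HTensor H K) :
    tensorMap X' Y' (tensorMap X Y u) = tensorMap (X'.comp X) (Y'.comp Y) u := by
  rw [← tensorMap_comp]; rfl

theorem tensorMap_id_right_comp_id_left (X : H →L[ℂ] H') (Y : K →L[ℂ] K') :
    (tensorMap X (ContinuousLinearMap.id ℂ K')).comp (tensorMap (ContinuousLinearMap.id ℂ H) Y) =
      tensorMap X Y := by
  rw [tensorMap_comp, ContinuousLinearMap.comp_id, ContinuousLinearMap.id_comp]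

theorem htmul_add_left (x x' : H) (y : K) : htmul (x + x') y = htmul x y + htmul x' y := by
  rw [htmul, TensorProduct.add_tmul]; exact UniformSpace.Completion.coe_add _ _

theorem htmul_add_right (x : H) (y y' : K) : htmul x (y + y') = htmul x y + htmul x y' := by
  rw [htmul, TensorProduct.tmul_add]; exact UniformSpace.Completion.coe_add _ _

theorem htmul_smul_left (c : ℂ) (x : H) (y : K) : htmul (c • x) y = c • htmul x y := by
  simp [htmul, ← TensorProduct.smul_tmul']

theorem htmul_smul_right (c : ℂ) (x : H) (y : K) : htmul x (c • y) = c • htmul x y := by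
  simp [htmul]

theorem tensorMap_id :
    tensorMap (ContinuousLinearMap.id ℂ H) (ContinuousLinearMap.id ℂ K) =
      ContinuousLinearMap.id ℂ (HTensor H K) :=
  clm_ext fun x y => by simp

theorem tensorMap_add_left (X X' : H →L[ℂ] H') (Y : K →L[ℂ] K') :
    tensorMap (X + X') Y = tensorMap X Y + tensorMap X' Y :=
  clm_ext fun x y => by simp [htmul_add_left]

theorem tensorMap_add_right (X : H →L[ℂ] H') (Y Y' : K →L[ℂ] K') :
    tensorMap X (Y + Y') = tensorMap X Y + tensorMap X Y' :=
  clm_ext fun x y => by simp [htmul_add_right]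

theorem tensorMap_smul_left (c : ℂ) (X : H →L[ℂ] H') (Y : K →L[ℂ] K') :
    tensorMap (c • X) Y = c • tensorMap X Y :=
  clm_ext fun x y => by simp [htmul_smul_left]

theorem tensorMap_smul_right (c : ℂ) (X : H →L[ℂ] H') (Y : K →L[ℂ] K') :
    tensorMap X (c • Y) = c • tensorMap X Y :=
  clm_ext fun x y => by simp [htmul_smul_right]

theorem tensorMap_zero_left (Y : K →L[ℂ] K') : tensorMap (0 : H →L[ℂ] H') Y = 0 := by
  simpa using tensorMap_smul_left 0 (0 : H →L[ℂ] H') Y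

theorem tensorMap_zero_right (X : H →L[ℂ] H') : tensorMap X (0 : K →L[ℂ] K') = 0 := by
  simpa using tensorMap_smul_right 0 X (0 : K →L[ℂ] K')

theorem tensorMap_sub_left (X X' : H →L[ℂ] H') (Y : K →L[ℂ] K') :
    tensorMap (X - X') Y = tensorMap X Y - tensorMap X' Y := by
  rw [eq_sub_iff_add_eq, ← tensorMap_add_left, sub_add_cancel]

theorem tensorMap_sub_right (X : H →L[ℂ] H') (Y Y' : K →L[ℂ] K') :
    tensorMap X (Y - Y') = tensorMap X Y - tensorMap X Y' := by
  rw [eq_sub_iff_add_eq, ← tensorMap_add_right, sub_add_cancel]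

theorem tensorMap_sum_right {ι : Type*} (s : Finset ι) (X : H →L[ℂ] H') (Y : ι → K →L[ℂ] K') :
    tensorMap X (∑ i ∈ s, Y i) = ∑ i ∈ s, tensorMap X (Y i) := by
  classical
  induction s using Finset.induction_on with
  | empty => simp [tensorMap_zero_right]
  | insert i s hi ih => rw [Finset.sum_insert hi, Finset.sum_insert hi, tensorMap_add_right, ih]

theorem norm_tensorMap_le (X : H →L[ℂ] H') (Y : K →L[ℂ] K') :
    ‖tensorMap X Y‖ ≤ ‖X‖ * ‖Y‖ := by
  refine ContinuousLinearMap.opNorm_le_bound _ (by positivity) fun u => ?_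
  induction u using UniformSpace.Completion.induction_on with
  | hp => exact isClosed_le (by fun_prop) (by fun_prop)
  | ih a =>
    simp only [tensorMap, ContinuousLinearMap.completion_apply_coe,
      UniformSpace.Completion.norm_coe]
    exact (ContinuousLinearMap.le_opNorm _ _).trans
      (mul_le_mul_of_nonneg_right (TensorProduct.norm_mapL_le X Y) (norm_nonneg _))

theorem adjoint_tensorMap [CompleteSpace H] [CompleteSpace H'] [CompleteSpace K] [CompleteSpace K']
    (X : H →L[ℂ] H') (Y : K →L[ℂ] K') :
    ContinuousLinearMap.adjoint (tensorMap X Y) =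
      tensorMap (ContinuousLinearMap.adjoint X) (ContinuousLinearMap.adjoint Y) := by
  refine clm_ext fun x y => ?_
  rw [← sub_eq_zero]
  refine eq_zero_of_inner_htmul fun x' y' => ?_
  rw [inner_sub_left, ContinuousLinearMap.adjoint_inner_left, tensorMap_htmul, tensorMap_htmul,
    inner_htmul, inner_htmul, ContinuousLinearMap.adjoint_inner_left,
    ContinuousLinearMap.adjoint_inner_left, sub_self]

/-- If `X` is injective, then so is `X ⊗ I`: the range of `X†` is dense, so a vector in the kernel
of `X ⊗ I` is orthogonal to all elementary tensors. -/
theorem tensorMap_injective [CompleteSpace H] [CompleteSpace H'] [CompleteSpace K]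
    {X : H →L[ℂ] H'} (hX : Function.Injective X) :
    Function.Injective (tensorMap X (ContinuousLinearMap.id ℂ K)) := by
  refine (injective_iff_map_eq_zero _).2 fun u hu => eq_zero_of_inner_htmul fun x y => ?_
  have hd :
      (LinearMap.range (ContinuousLinearMap.adjoint X).toLinearMap).topologicalClosure = ⊤ := by
    rw [Submodule.topologicalClosure_eq_top_iff, ContinuousLinearMap.orthogonal_range,
      ContinuousLinearMap.adjoint_adjoint]
    exact LinearMap.ker_eq_bot.2 hX
  have hx :
      x ∈ (LinearMap.range (ContinuousLinearMap.adjoint X).toLinearMap).topologicalClosure := by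
    rw [hd]; trivial
  have hc : IsClosed {x : H | ⟪u, htmul x y⟫_ℂ = 0} :=
    isClosed_eq (continuous_const.inner
      (continuous_htmul.comp (continuous_id.prodMk continuous_const))) continuous_const
  refine closure_minimal ?_ hc hx
  rintro _ ⟨w, rfl⟩
  have h1 : htmul ((ContinuousLinearMap.adjoint X) w) y =
      (ContinuousLinearMap.adjoint (tensorMap X (ContinuousLinearMap.id ℂ K))) (htmul w y) := by
    rw [adjoint_tensorMap, tensorMap_htmul, ContinuousLinearMap.adjoint_id]; rfl
  change ⟪u, htmul ((ContinuousLinearMap.adjoint X) w) y⟫_ℂ = 0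
  rw [h1, ContinuousLinearMap.adjoint_inner_right, hu, inner_zero_left]

end TensorMap

/-! ### Spectral subspaces -/

section SpectralSubspaces

variable {K : Type*} [NormedAddCommGroup K] [InnerProductSpace ℂ K] [CompleteSpace K]
  {T : K →L[ℂ] K}

instance (T : K →L[ℂ] K) (U : Set ℝ) : CompleteSpace (openSpectralSubspace T U) :=
  (Submodule.isClosed_topologicalClosure _).completeSpace_coe

theorem cfc_mem_openSpectralSubspace {U : Set ℝ} {f : ℝ → ℝ} (hf : Continuous f)
    (hU : tsupport f ⊆ U) (x : K) : cfc f T x ∈ openSpectralSubspace T U :=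
  Submodule.le_topologicalClosure _
    (Submodule.mem_iSup_of_mem (⟨⟨f, hf⟩, hU⟩ : {f : C(ℝ, ℝ) // tsupport f ⊆ U}) ⟨x, rfl⟩)

theorem openSpectralSubspace_le {U : Set ℝ} {N : Submodule ℂ K} (hN : IsClosed (N : Set K))
    (h : ∀ f : ℝ → ℝ, Continuous f → tsupport f ⊆ U → ∀ x, cfc f T x ∈ N) :
    openSpectralSubspace T U ≤ N := by
  refine Submodule.topologicalClosure_minimal _ (iSup_le fun f => ?_) hN
  rintro _ ⟨x, rfl⟩
  exact h f.1 f.1.continuous f.2 x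

theorem openSpectralSubspace_mono {U V : Set ℝ} (h : U ⊆ V) :
    openSpectralSubspace T U ≤ openSpectralSubspace T V :=
  openSpectralSubspace_le (Submodule.isClosed_topologicalClosure _) fun _ hf hU _ =>
    cfc_mem_openSpectralSubspace hf (hU.trans h) _

theorem spectralSubspace_le {δ U : Set ℝ} (hU : IsOpen U) (h : δ ⊆ U) :
    spectralSubspace T δ ≤ openSpectralSubspace T U :=
  iInf_le (fun U : {U : Set ℝ // IsOpen U ∧ δ ⊆ U} => openSpectralSubspace T U.1) ⟨U, hU, h⟩

theorem inner_cfc_left (f : ℝ → ℝ) (x y : K) : ⟪cfc f T x, y⟫_ℂ = ⟪x, cfc f T y⟫_ℂ :=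
  ContinuousLinearMap.isSelfAdjoint_iff_isSymmetric.1 (cfc_predicate f T) x y

/-- The operator `f(T)` vanishes on the spectral subspace of the complement of `supp f`. -/
theorem cfc_apply_eq_zero {f : ℝ → ℝ} (hf : Continuous f) {y : K}
    (hy : y ∈ openSpectralSubspace T (tsupport f)ᶜ) : cfc f T y = 0 := by
  have : openSpectralSubspace T (tsupport f)ᶜ ≤ LinearMap.ker (cfc f T).toLinearMap := by
    refine openSpectralSubspace_le (cfc f T).isClosed_ker fun g hg hgs x => ?_
    have h0 : cfc f T * cfc g T = 0 := by
      rw [← cfc_mul f g T hf.continuousOn hg.continuousOn]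
      have : (fun t => f t * g t) = fun _ => 0 := by
        funext t
        by_cases ht : t ∈ tsupport f
        · rw [image_eq_zero_of_notMem_tsupport (f := g) fun h => hgs h ht, mul_zero]
        · rw [image_eq_zero_of_notMem_tsupport ht, zero_mul]
      rw [this, cfc_const_zero]
    exact congrArg (fun B : K →L[ℂ] K => B x) h0
  exact this hy

/-- The spectral subspace of an open set is orthogonal to that of a disjoint set. -/
theorem openSpectralSubspace_isOrtho {U δ : Set ℝ} (h : Disjoint U δ) :
    openSpectralSubspace T U ⟂ spectralSubspace T δ := by
  rw [Submodule.isOrtho_iff_le]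
  refine openSpectralSubspace_le (Submodule.isClosed_orthogonal _) fun f hf hU x => ?_
  rw [Submodule.mem_orthogonal']
  intro y hy
  rw [inner_cfc_left, cfc_apply_eq_zero hf, inner_zero_right]
  exact spectralSubspace_le (isClosed_tsupport f).isOpen_compl
    (fun t ht htf => h.le_bot ⟨hU htf, ht⟩) hy

theorem starProjection_comm_of_invariant {N : Submodule ℂ K} [N.HasOrthogonalProjection]
    {B : K →L[ℂ] K} (hB : IsSelfAdjoint B) (h : ∀ x ∈ N, B x ∈ N) (x : K) :
    N.starProjection (B x) = B (N.starProjection x) := by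
  refine Submodule.eq_starProjection_of_mem_orthogonal (h _ (N.starProjection_apply_mem x)) ?_
  rw [← map_sub, Submodule.mem_orthogonal]
  intro n hn
  have hs : ⟪B n, x - N.starProjection x⟫_ℂ = ⟪n, B (x - N.starProjection x)⟫_ℂ :=
    ContinuousLinearMap.isSelfAdjoint_iff_isSymmetric.1 hB n _
  rw [← hs]
  exact (Submodule.mem_orthogonal _ _).1 (N.sub_starProjection_mem_orthogonal x) _ (h n hn)

theorem cfc_mem_of_mem (f : ℝ → ℝ) {U : Set ℝ} {x : K}
    (hx : x ∈ openSpectralSubspace T U) : cfc f T x ∈ openSpectralSubspace T U := by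
  have : openSpectralSubspace T U ≤
      (openSpectralSubspace T U).comap (cfc f T).toLinearMap := by
    refine openSpectralSubspace_le ((Submodule.isClosed_topologicalClosure _).preimage
      (cfc f T).continuous) fun g hg hgs x => ?_
    have h0 : cfc f T * cfc g T = cfc g T * cfc f T := (cfc_commute_cfc f g T).eq
    have h1 := congrArg (fun B : K →L[ℂ] K => B x) h0
    change cfc f T (cfc g T x) ∈ openSpectralSubspace T U
    rw [show cfc f T (cfc g T x) = cfc g T (cfc f T x) from h1]
    exact cfc_mem_openSpectralSubspace hg hgs _
  exact this hx

theorem apply_mem_spectralSubspace (hT : IsSelfAdjoint T) {δ : Set ℝ} {x : K}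
    (hx : x ∈ spectralSubspace T δ) : T x ∈ spectralSubspace T δ := by
  rw [spectralSubspace, Submodule.mem_iInf] at hx ⊢
  intro U
  have := cfc_mem_of_mem id (hx U)
  rwa [cfc_id ℝ T hT] at this

/-- Disjoint closed sets of reals are separated by a continuous function that is `1` on a
neighbourhood of the first and `0` on a neighbourhood of the second. -/
theorem exists_cutoff {C D : Set ℝ} (hC : IsClosed C) (hD : IsClosed D) (h : Disjoint C D) :
    ∃ f : ℝ → ℝ, Continuous f ∧ tsupport f ⊆ Dᶜ ∧ ∃ O, IsOpen O ∧ C ⊆ O ∧ Set.EqOn f 1 O := by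
  obtain ⟨O, hO, hCO, hOD⟩ := normal_exists_closure_subset hC hD.isOpen_compl
    (fun t ht hD => h.le_bot ⟨ht, hD⟩)
  obtain ⟨O', hO', hOO', hO'D⟩ := normal_exists_closure_subset isClosed_closure hD.isOpen_compl hOD
  obtain ⟨f, hf0, hf1, -⟩ := exists_continuous_zero_one_of_isClosed hO'.isClosed_compl
    (isClosed_closure (s := O)) (Set.disjoint_left.2 fun t ht ht' => ht (hOO' ht'))
  refine ⟨f, f.continuous, (closure_mono fun t ht => ?_).trans hO'D, O, hO, hCO,
    hf1.mono subset_closure⟩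
  by_contra hn
  exact ht (hf0 hn)

/-- On vectors orthogonal to the spectral subspace of `(-∞, p)`, only the part of `supp f` to the
right of `p` matters for `f(T)`. -/
theorem cfc_mem_of_orthogonal {p : ℝ} {U : Set ℝ} (hU : IsOpen U)
    {f : ℝ → ℝ} (hf : Continuous f) (hfU : tsupport f ∩ Set.Ici p ⊆ U) {y : K}
    (hy : y ∈ (openSpectralSubspace T (Set.Iio p))ᗮ) : cfc f T y ∈ openSpectralSubspace T U := by
  obtain ⟨ψ, hψ, hψs, O, hO, hCO, hψO⟩ := exists_cutoff
    ((isClosed_tsupport f).inter hU.isClosed_compl) (isClosed_Ici (a := p))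
    (Set.disjoint_left.2 fun t ht ht' => ht.2 (hfU ⟨ht.1, ht'⟩))
  have h0 : cfc ψ T y = 0 := by
    rw [← inner_self_eq_zero (𝕜 := ℂ), inner_cfc_left, ← inner_conj_symm]
    rw [(Submodule.mem_orthogonal _ _).1 hy _ ?_, map_zero]
    exact cfc_mem_openSpectralSubspace hψ
      (hψs.trans fun t ht => by simpa using ht) _
  have h1 : cfc (fun t => f t * (1 - ψ t)) T y = cfc f T y := by
    have : cfc (fun t => f t * (1 - ψ t)) T = cfc f T - cfc f T * cfc ψ T := by
      rw [← cfc_mul f ψ T hf.continuousOn hψ.continuousOn,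
        ← cfc_sub f (fun t => f t * ψ t) T hf.continuousOn (hf.mul hψ).continuousOn]
      congr 1; funext t; ring
    rw [this]
    change cfc f T y - cfc f T (cfc ψ T y) = _
    rw [h0, map_zero, sub_zero]
  rw [← h1]
  refine cfc_mem_openSpectralSubspace (by fun_prop) ?_ _
  intro t ht
  by_contra htU
  have htf : t ∈ tsupport f := tsupport_mul_subset_left ht
  have htO : t ∈ Oᶜ := by
    refine closure_minimal (s := Function.support fun t => f t * (1 - ψ t)) (t := Oᶜ)
      (fun s hs hsO => hs ?_) hO.isClosed_compl ht
    change f s * (1 - ψ s) = 0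
    rw [hψO hsO]; simp
  exact htO (hCO ⟨htf, htU⟩)

theorem spectralSubspace_le_orthogonal {p : ℝ} {δ : Set ℝ}
    (h : δ ⊆ Set.Ici p) : spectralSubspace T δ ≤ (openSpectralSubspace T (Set.Iio p))ᗮ :=
  Submodule.isOrtho_iff_le.1 (openSpectralSubspace_isOrtho
    (Set.disjoint_left.2 fun t (ht : t < p) ht' => not_le.2 ht (h ht'))).symm

theorem spectralSubspace_Ico (p q : ℝ) :
    spectralSubspace T (Set.Ico p q) =
      openSpectralSubspace T (Set.Iio q) ⊓ (openSpectralSubspace T (Set.Iio p))ᗮ := by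
  refine le_antisymm (le_inf (spectralSubspace_le isOpen_Iio fun t ht => ht.2)
    (spectralSubspace_le_orthogonal fun t ht => ht.1)) ?_
  rintro x ⟨hxq, hxp⟩
  rw [spectralSubspace, Submodule.mem_iInf]
  rintro ⟨U, hU, hpq⟩
  set N := openSpectralSubspace T (Set.Iio p)
  have key : openSpectralSubspace T (Set.Iio q) ≤
      (openSpectralSubspace T U).comap (Nᗮ.starProjection).toLinearMap := by
    refine openSpectralSubspace_le ((Submodule.isClosed_topologicalClosure _).preimage
      (Nᗮ.starProjection).continuous) fun f hf hfq y => ?_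
    change Nᗮ.starProjection (cfc f T y) ∈ openSpectralSubspace T U
    rw [starProjection_comm_of_invariant (cfc_predicate f T)]
    · exact cfc_mem_of_orthogonal hU hf (fun t ht => hpq ⟨ht.2, hfq ht.1⟩)
        (Submodule.starProjection_apply_mem _ _)
    · intro x hx
      rw [Submodule.mem_orthogonal] at hx ⊢
      intro n hn
      rw [← inner_cfc_left]
      exact hx _ (cfc_mem_of_mem f hn)
  have := key hxq
  change Nᗮ.starProjection x ∈ openSpectralSubspace T U at this
  rwa [Submodule.starProjection_eq_self_iff.2 hxp] at this

theorem spectralSubspace_Icc (hT : IsSelfAdjoint T) {p b : ℝ} (hb : ∀ t ∈ spectrum ℝ T, t ≤ b) :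
    spectralSubspace T (Set.Icc p b) = (openSpectralSubspace T (Set.Iio p))ᗮ := by
  refine le_antisymm (spectralSubspace_le_orthogonal fun t ht => ht.1) fun x hx => ?_
  rw [spectralSubspace, Submodule.mem_iInf]
  rintro ⟨U, hU, hpb⟩
  obtain ⟨f, hf, hfs, O, -, hCO, hfO⟩ := exists_cutoff (isClosed_Iic (a := b))
    ((isClosed_Ici (a := p)).inter hU.isClosed_compl)
    (Set.disjoint_left.2 fun t ht ht' => ht'.2 (hpb ⟨ht'.1, ht⟩))
  have h1 : cfc f T = 1 := by
    rw [cfc_congr (g := fun _ => (1 : ℝ)) fun t ht => hfO (hCO (hb t ht)), cfc_const_one ℝ T]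
  have := cfc_mem_of_orthogonal hU hf
    (fun t ht => by_contra fun h => hfs ht.1 ⟨ht.2, h⟩) hx
  rwa [h1] at this

theorem openSpectralSubspace_eq_bot {U : Set ℝ} (hU : ∀ t ∈ spectrum ℝ T, t ∉ U) :
    openSpectralSubspace T U = ⊥ := by
  refine le_bot_iff.1 (openSpectralSubspace_le isClosed_singleton fun f hf hfU x => ?_)
  rw [cfc_congr (g := fun _ => (0 : ℝ)) fun t ht =>
    image_eq_zero_of_notMem_tsupport fun h => hU t ht (hfU h), cfc_const_zero]
  rfl

theorem starProjection_inf_orthogonal {E : Type*} [NormedAddCommGroup E] [InnerProductSpace ℂ E]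
    {M N L : Submodule ℂ E} [M.HasOrthogonalProjection]
    [N.HasOrthogonalProjection] [L.HasOrthogonalProjection] (h : M ≤ N) (hL : L = N ⊓ Mᗮ) :
    L.starProjection = N.starProjection - M.starProjection := by
  ext x
  refine Submodule.eq_starProjection_of_mem_orthogonal ?_ ?_
  · rw [hL]
    refine ⟨sub_mem (N.starProjection_apply_mem x) (h (M.starProjection_apply_mem x)), ?_⟩
    have := sub_mem (M.sub_starProjection_mem_orthogonal x)
      (Submodule.orthogonal_le h (N.sub_starProjection_mem_orthogonal x))
    simpa using this
  · rw [hL]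
    have h1 : x - N.starProjection x ∈ (N ⊓ Mᗮ)ᗮ :=
      Submodule.orthogonal_le inf_le_left (N.sub_starProjection_mem_orthogonal x)
    have h2 : M.starProjection x ∈ (N ⊓ Mᗮ)ᗮ :=
      Submodule.orthogonal_le inf_le_right
        (Submodule.le_orthogonal_orthogonal _ (M.starProjection_apply_mem x))
    have := add_mem h1 h2
    simpa [sub_add] using this

/-- The radial retraction of the complex plane onto the disc of radius `r`. -/
noncomputable def radialClamp (r : ℝ) (w : ℂ) : ℂ := ((r / max r ‖w‖ : ℝ) : ℂ) * w

theorem norm_radialClamp_le {r : ℝ} (hr : 0 < r) (w : ℂ) : ‖radialClamp r w‖ ≤ r := by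
  have hm : 0 < max r ‖w‖ := lt_max_of_lt_left hr
  rw [radialClamp, norm_mul, Complex.norm_real, Real.norm_of_nonneg (by positivity),
    div_mul_eq_mul_div, div_le_iff₀ hm]
  exact mul_le_mul_of_nonneg_left (le_max_right _ _) hr.le

theorem radialClamp_eq {r : ℝ} (hr : 0 < r) {w : ℂ} (hw : ‖w‖ ≤ r) : radialClamp r w = w := by
  rw [radialClamp, max_eq_left hw, div_self hr.ne']; simp

theorem continuous_radialClamp {r : ℝ} (hr : 0 < r) : Continuous (radialClamp r) := by
  have : ∀ w : ℂ, max r ‖w‖ ≠ 0 := fun w => (lt_max_of_lt_left hr).ne'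
  unfold radialClamp
  exact (Complex.continuous_ofReal.comp (continuous_const.div (by fun_prop) this)).mul continuous_id

/-- If `g` is within `r` of the constant `w` on `U`, then `g(T)` is within `r` of `w` on the
spectral subspace of `U`: there `g(T) - w` agrees with `h(T)`, where `h` is `g - w` clamped to the
disc of radius `r`. -/
theorem norm_cfc_sub_smul_le (hT : IsSelfAdjoint T) {g : ℂ → ℂ}
    (hg : ContinuousOn g (spectrum ℂ T)) {U : Set ℝ} {w : ℂ} {r : ℝ} (hr : 0 < r)
    (h : ∀ t ∈ U, ‖g t - w‖ ≤ r) {y : K} (hy : y ∈ openSpectralSubspace T U) :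
    ‖cfc g T y - w • y‖ ≤ r * ‖y‖ := by
  have hN : IsStarNormal T := hT.isStarNormal
  set k : ℂ → ℂ := fun s => radialClamp r (g s - w) with hk
  have hkc : ContinuousOn k (spectrum ℂ T) :=
    (continuous_radialClamp hr).comp_continuousOn (hg.sub continuousOn_const)
  have key : openSpectralSubspace T U ≤
      LinearMap.ker (cfc k T - (cfc g T - w • 1)).toLinearMap := by
    refine openSpectralSubspace_le (ContinuousLinearMap.isClosed_ker _) fun f hf hfU x => ?_
    have hfc : ContinuousOn (fun s : ℂ => (f s.re : ℂ)) (spectrum ℂ T) := by fun_prop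
    have e1 : cfc (fun s : ℂ => k s * (f s.re : ℂ)) T =
        cfc (fun s : ℂ => (g s - w) * (f s.re : ℂ)) T := by
      refine cfc_congr fun s hs => ?_
      by_cases hfs : f s.re = 0
      · simp [hfs]
      · have hre : ((s.re : ℝ) : ℂ) = s := by
          have := SpectrumRestricts.real_iff.mp hT.spectrumRestricts s hs
          exact this.symm
        have hsU : s.re ∈ U := hfU (subset_tsupport _ hfs)
        have := h _ hsU
        rw [hre] at this
        simp only [hk, radialClamp_eq hr this]
    rw [cfc_mul k _ T hkc hfc, cfc_mul (fun s => g s - w) _ T (hg.sub continuousOn_const) hfc,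
      cfc_sub g (fun _ => w) T hg continuousOn_const, cfc_const w T,
      Algebra.algebraMap_eq_smul_one, ← cfc_real_eq_complex f hT] at e1
    have := congrArg (fun B : K →L[ℂ] K => B x) e1
    exact sub_eq_zero.2 this
  have h1 : cfc k T y = cfc g T y - w • y := sub_eq_zero.1 (key hy)
  rw [← h1]
  refine (ContinuousLinearMap.le_opNorm _ _).trans (mul_le_mul_of_nonneg_right ?_ (norm_nonneg _))
  exact norm_cfc_le hr.le fun s _ => norm_radialClamp_le hr _

end SpectralSubspaces

/-! ### Tagged partitions and their spectral projections -/

namespace TaggedPartition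

variable {a b : ℝ} (P : TaggedPartition a b)

theorem pt_le_succ (i : Fin (P.n + 1)) : P.pt i.castSucc ≤ P.pt i.succ := by
  have := P.tag_mem i
  split_ifs at this
  · exact this.1.trans this.2
  · exact this.1.trans this.2.le

theorem monotone_pt : Monotone P.pt := Fin.monotone_iff_le_succ.2 P.pt_le_succ

theorem cell_subset_Icc (i : Fin (P.n + 1)) :
    P.cell i ⊆ Set.Icc (P.pt i.castSucc) (P.pt i.succ) := by
  unfold cell
  split_ifs
  · exact subset_rfl
  · exact Set.Ico_subset_Icc_self

theorem tag_mem_cell (i : Fin (P.n + 1)) : P.tag i ∈ P.cell i := P.tag_mem i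

theorem tag_mem_Icc (i : Fin (P.n + 1)) : P.tag i ∈ Set.Icc a b := by
  have := P.cell_subset_Icc i (P.tag_mem_cell i)
  exact ⟨P.pt_zero.ge.trans ((P.monotone_pt (Fin.zero_le _)).trans this.1),
    this.2.trans ((P.monotone_pt (Fin.le_last _)).trans P.pt_last.le)⟩

/-- There are tagged partitions of arbitrarily small mesh. -/
theorem exists_meshLt (hab : a ≤ b) {d : ℝ} (hd : 0 < d) :
    ∃ P : TaggedPartition a b, P.MeshLt d := by
  rcases hab.eq_or_lt with rfl | hab
  · refine ⟨⟨0, fun _ => a, rfl, rfl, fun _ => a, fun i => ?_⟩, fun i => by simpa using hd⟩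
    rw [if_pos (Fin.ext (by omega))]
    exact ⟨le_rfl, le_rfl⟩
  · obtain ⟨n, hn⟩ := exists_nat_gt ((b - a) / d)
    have hn1 : (0 : ℝ) < n + 1 := by positivity
    have hstep : 0 < (b - a) / (n + 1) := div_pos (sub_pos.2 hab) hn1
    have hlt : ∀ i : Fin (n + 1), a + (b - a) / (n + 1) * (i.castSucc : ℕ) <
        a + (b - a) / (n + 1) * (i.succ : ℕ) := by
      intro i
      simp only [Fin.val_castSucc, Fin.val_succ, Nat.cast_add, Nat.cast_one]
      linarith
    refine ⟨⟨n, fun i => a + (b - a) / (n + 1) * (i : ℕ), by simp, ?_,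
      fun i => a + (b - a) / (n + 1) * (i.castSucc : ℕ), fun i => ?_⟩, fun i => ?_⟩
    · simp only [Fin.val_last, Nat.cast_add, Nat.cast_one]
      field_simp
      ring
    · split_ifs
      · exact ⟨le_rfl, (hlt i).le⟩
      · exact ⟨le_rfl, hlt i⟩
    · simp only [Fin.val_castSucc, Fin.val_succ, Nat.cast_add, Nat.cast_one]
      have : (b - a) / (n + 1) < d := by
        rw [div_lt_iff₀ hn1]
        rw [div_lt_iff₀ hd] at hn
        nlinarith
      linarith

end TaggedPartition

section SpectralMeasureOfCells

variable {K : Type*} [NormedAddCommGroup K] [InnerProductSpace ℂ K] [CompleteSpace K]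
  {T : K →L[ℂ] K} (P : TaggedPartition (sInf (spectrum ℝ T)) (sSup (spectrum ℝ T)))

theorem isCompact_spectrum_real (hT : IsSelfAdjoint T) : IsCompact (spectrum ℝ T) :=
  have := hT
  ContinuousFunctionalCalculus.isCompact_spectrum T

/-- The spectral projections of the cells of a partition add up to the identity: they are the
differences of consecutive projections of an increasing family. -/
theorem sum_spectralMeasure_cell (hT : IsSelfAdjoint T) :
    ∑ i, spectralMeasure T (P.cell i) = ContinuousLinearMap.id ℂ K := by
  have hc := isCompact_spectrum_real hT
  set Q : Fin (P.n + 2) → K →L[ℂ] K := fun k => if k = Fin.last (P.n + 1) then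
    ContinuousLinearMap.id ℂ K else (openSpectralSubspace T (Set.Iio (P.pt k))).starProjection
    with hQ
  have hE : ∀ i, spectralMeasure T (P.cell i) = Q i.succ - Q i.castSucc := by
    intro i
    have h1 : Q i.castSucc =
        (openSpectralSubspace T (Set.Iio (P.pt i.castSucc))).starProjection := by
      simp only [hQ]
      rw [if_neg (Fin.castSucc_lt_last i).ne]
    rw [h1]
    by_cases hi : i = Fin.last P.n
    · have h2 : Q i.succ = (⊤ : Submodule ℂ K).starProjection := by
        simp only [hQ]
        rw [if_pos (by rw [hi, Fin.succ_last]), Submodule.starProjection_top]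
      have h3 : P.pt i.succ = sSup (spectrum ℝ T) := by rw [hi, Fin.succ_last, P.pt_last]
      rw [h2]
      refine starProjection_inf_orthogonal le_top ?_
      rw [top_inf_eq, TaggedPartition.cell, if_pos hi, h3]
      exact spectralSubspace_Icc hT fun t ht => le_csSup hc.bddAbove ht
    · have h2 : Q i.succ = (openSpectralSubspace T (Set.Iio (P.pt i.succ))).starProjection := by
        simp only [hQ]
        rw [if_neg]
        rw [← Fin.succ_last]
        exact fun h => hi (Fin.succ_injective _ h)
      rw [h2]
      refine starProjection_inf_orthogonal
        (openSpectralSubspace_mono (Set.Iio_subset_Iio (P.pt_le_succ i))) ?_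
      rw [TaggedPartition.cell, if_neg hi]
      exact spectralSubspace_Ico _ _
  have h0 : Q 0 = 0 := by
    simp only [hQ]
    rw [if_neg (Fin.last_pos).ne]
    ext x
    have hm := Submodule.starProjection_apply_mem (openSpectralSubspace T (Set.Iio (P.pt 0))) x
    have hbot : openSpectralSubspace T (Set.Iio (P.pt 0)) = ⊥ :=
      openSpectralSubspace_eq_bot fun t ht ht' =>
        not_le.2 ht' (P.pt_zero.le.trans (csInf_le hc.bddBelow ht))
    exact (Submodule.mem_bot ℂ).1 (hbot.le hm)
  have hlast : Q (Fin.last _) = ContinuousLinearMap.id ℂ K := by simp [hQ]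
  have hs := (Fin.sum_univ_castSucc Q).symm.trans (Fin.sum_univ_succ Q)
  rw [h0, zero_add, hlast] at hs
  simp_rw [hE]
  rw [Finset.sum_sub_distrib, ← hs]
  simp

theorem spectralSubspace_cell_isOrtho {i j : Fin (P.n + 1)} (h : i ≠ j) :
    spectralSubspace T (P.cell i) ⟂ spectralSubspace T (P.cell j) := by
  wlog hij : i < j generalizing i j
  · exact (this h.symm (lt_of_le_of_ne (not_lt.1 hij) h.symm)).symm
  have hi : P.cell i = Set.Ico (P.pt i.castSucc) (P.pt i.succ) :=
    if_neg (hij.trans_le (Fin.le_last _)).ne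
  have hle : spectralSubspace T (P.cell i) ≤
      openSpectralSubspace T (Set.Iio (P.pt i.succ)) :=
    spectralSubspace_le isOpen_Iio (by rw [hi]; exact fun t ht => ht.2)
  refine (openSpectralSubspace_isOrtho ?_).mono_left hle
  refine Set.disjoint_left.2 fun t (ht : t < _) ht' => not_le.2 ht ?_
  exact (P.monotone_pt (by simpa [Fin.le_def] using hij)).trans (P.cell_subset_Icc j ht').1

/-- On the spectral subspace of a cell of mesh less than `d`, the operator `g(T)` is within `r` of
`g(x)` if `g` varies by at most `r` over distances less than `d`. -/
theorem norm_cfc_cell_le (hT : IsSelfAdjoint T) {g : ℂ → ℂ} (hg : ContinuousOn g (spectrum ℂ T))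
    {d r : ℝ} (hr : 0 < r) (hP : P.MeshLt d) (i : Fin (P.n + 1))
    (h : ∀ t : ℝ, |t - P.tag i| < d → ‖g t - g (P.tag i)‖ ≤ r) {y : K}
    (hy : y ∈ spectralSubspace T (P.cell i)) :
    ‖cfc g T y - g (P.tag i) • y‖ ≤ r * ‖y‖ := by
  have ht := P.cell_subset_Icc i (P.tag_mem_cell i)
  refine norm_cfc_sub_smul_le hT hg hr (U := Set.Ioo (P.tag i - d) (P.tag i + d))
    (fun t ht => h t ?_) (spectralSubspace_le isOpen_Ioo (fun t ht' => ?_) hy)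
  · rw [abs_lt]; constructor <;> linarith [ht.1, ht.2]
  · have h1 := P.cell_subset_Icc i ht'
    have h2 := hP i
    constructor <;> linarith [ht.1, ht.2, h1.1, h1.2]

end SpectralMeasureOfCells

/-! ### The graph space -/

section GraphSpaceLemmas

variable {H : Type*} [NormedAddCommGroup H] [InnerProductSpace ℂ H]

/-- The element `(f, B f)` of the graph space. -/
def graphMk (B : H →ₗ.[ℂ] H) (f : B.domain) : graphSpace B :=
  ⟨WithLp.toLp 2 ((f : H), B f), B.mem_graph f⟩

@[simp] theorem graphEmb_graphMk (B : H →ₗ.[ℂ] H) (f : B.domain) :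
    graphEmb B (graphMk B f) = f := rfl

@[simp] theorem graphVal_graphMk (B : H →ₗ.[ℂ] H) (f : B.domain) :
    graphVal B (graphMk B f) = B f := rfl

theorem graphEmb_injective (B : H →ₗ.[ℂ] H) : Function.Injective (graphEmb B) := by
  intro u v h
  have h1 : graphToDomain B u = graphToDomain B v := Subtype.ext h
  have h2 : graphVal B u = graphVal B v := by
    rw [← apply_graphToDomain, ← apply_graphToDomain, h1]
  exact Subtype.ext ((WithLp.ofLp_injective 2) (Prod.ext h h2))

theorem norm_graphSpace_sq (B : H →ₗ.[ℂ] H) (u : graphSpace B) :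
    ‖u‖ ^ 2 = ‖graphEmb B u‖ ^ 2 + ‖graphVal B u‖ ^ 2 :=
  WithLp.prod_norm_sq_eq_of_L2 (u : WithLp 2 (H × H))

theorem norm_graphSpace_le (B : H →ₗ.[ℂ] H) (u : graphSpace B) :
    ‖u‖ ≤ ‖graphEmb B u‖ + ‖graphVal B u‖ := by
  have := norm_graphSpace_sq B u
  refine le_of_sq_le_sq ?_ (by positivity)
  nlinarith [norm_nonneg (graphEmb B u), norm_nonneg (graphVal B u)]

theorem norm_graphEmb_le (B : H →ₗ.[ℂ] H) (u : graphSpace B) : ‖graphEmb B u‖ ≤ ‖u‖ := by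
  have := norm_graphSpace_sq B u
  exact le_of_sq_le_sq (by nlinarith [sq_nonneg ‖graphVal B u‖]) (norm_nonneg _)

/-- The operator `B - z` on the graph space of `B`. -/
def graphSub (B : H →ₗ.[ℂ] H) (z : ℂ) : graphSpace B →L[ℂ] H := graphVal B - z • graphEmb B

theorem graphSub_apply (B : H →ₗ.[ℂ] H) (z : ℂ) (u : graphSpace B) :
    graphSub B z u = graphVal B u - z • graphEmb B u := rfl

end GraphSpaceLemmas

/-- A bounded operator from a Hilbert space onto a Hilbert space has a bounded right inverse. -/
theorem exists_rightInverse_of_surjective {E F : Type*} [NormedAddCommGroup E]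
    [InnerProductSpace ℂ E] [CompleteSpace E] [NormedAddCommGroup F] [InnerProductSpace ℂ F]
    [CompleteSpace F] (f : E →L[ℂ] F) (hf : Function.Surjective f) :
    ∃ R : F →L[ℂ] E, f.comp R = ContinuousLinearMap.id ℂ F := by
  set N : Submodule ℂ E := LinearMap.ker f.toLinearMap
  have hN : IsClosed (N : Set E) := f.isClosed_ker
  have : CompleteSpace N := hN.completeSpace_coe
  set g : Nᗮ →L[ℂ] F := f.comp Nᗮ.subtypeL
  have h1 : g.ker = ⊥ := by
    refine LinearMap.ker_eq_bot'.2 fun x hx => ?_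
    have : (x : E) ∈ N ⊓ Nᗮ := ⟨hx, x.2⟩
    rw [Submodule.inf_orthogonal_eq_bot] at this
    exact Subtype.ext ((Submodule.mem_bot ℂ).1 this)
  have h2 : g.range = ⊤ := by
    refine LinearMap.range_eq_top.2 fun y => ?_
    obtain ⟨x, rfl⟩ := hf y
    refine ⟨⟨x - N.starProjection x, N.sub_starProjection_mem_orthogonal x⟩, ?_⟩
    change f (x - N.starProjection x) = f x
    rw [map_sub, show f (N.starProjection x) = 0 from N.starProjection_apply_mem x, sub_zero]
  refine ⟨Nᗮ.subtypeL.comp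
    (ContinuousLinearEquiv.ofBijective g h1 h2).symm.toContinuousLinearMap, ?_⟩
  ext y
  exact ContinuousLinearEquiv.ofBijective_apply_symm_apply g h1 h2 y

/-- The open mapping theorem for an operator on a closed subspace. -/
theorem isInvertible_of_bijective {E F : Type*} [NormedAddCommGroup E] [NormedSpace ℂ E]
    [CompleteSpace E] [NormedAddCommGroup F] [NormedSpace ℂ F] [CompleteSpace F]
    {N : Submodule ℂ E} (hN : IsClosed (N : Set E)) (f : N →L[ℂ] F) (h1 : f.ker = ⊥)
    (h2 : f.range = ⊤) : f.IsInvertible := by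
  have : CompleteSpace N := hN.completeSpace_coe
  exact ⟨ContinuousLinearEquiv.ofBijective f h1 h2, rfl⟩

/-! ### Boundary triplets: `γ`-field and Weyl function -/

/-- The constant in the resolvent estimate for the graph norm. -/
noncomputable def resBound (z : ℂ) : ℝ := 1 + (1 + ‖z‖) / |z.im|

theorem resBound_pos (z : ℂ) : 0 < resBound z := by unfold resBound; positivity

namespace BoundaryTriplet

variable {H G : Type*}
  [NormedAddCommGroup H] [InnerProductSpace ℂ H] [CompleteSpace H]
  [NormedAddCommGroup G] [InnerProductSpace ℂ G]
  {A : H →ₗ.[ℂ] H}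

theorem le_adjoint (Bt : BoundaryTriplet A G) : A ≤ A† :=
  LinearPMap.IsFormalAdjoint.le_adjoint Bt.dense_domain Bt.symmetric

theorem completeSpace_graphSpace (Bt : BoundaryTriplet A G) : CompleteSpace (graphSpace A†) :=
  graphSpace_complete (LinearPMap.adjoint_isClosed Bt.dense_domain)

variable [CompleteSpace G] (Bt : BoundaryTriplet A G)

theorem green_hat (u v : graphSpace A†) :
    ⟪graphVal A† u, graphEmb A† v⟫_ℂ - ⟪graphEmb A† u, graphVal A† v⟫_ℂ =
      ⟪Bt.hatΓ₁ u, Bt.hatΓ₀ v⟫_ℂ - ⟪Bt.hatΓ₀ u, Bt.hatΓ₁ v⟫_ℂ := by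
  rw [← apply_graphToDomain, ← apply_graphToDomain]
  exact Bt.green (graphToDomain A† u) (graphToDomain A† v)

theorem hat_surjective (g h : G) : ∃ u, Bt.hatΓ₀ u = g ∧ Bt.hatΓ₁ u = h := by
  obtain ⟨f, h0, h1⟩ := Bt.surjective g h
  exact ⟨graphMk A† f, h0, h1⟩

/-- The boundary maps vanish on the domain of `A`. -/
theorem hat_eq_zero_of_mem {u : graphSpace A†} (hu : graphEmb A† u ∈ A.domain) :
    Bt.hatΓ₀ u = 0 ∧ Bt.hatΓ₁ u = 0 := by
  have key : ∀ v, ⟪Bt.hatΓ₁ u, Bt.hatΓ₀ v⟫_ℂ - ⟪Bt.hatΓ₀ u, Bt.hatΓ₁ v⟫_ℂ = 0 := by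
    intro v
    rw [← Bt.green_hat, sub_eq_zero]
    have h1 : graphVal A† u = A ⟨_, hu⟩ := by
      rw [← apply_graphToDomain]
      exact (Bt.le_adjoint.2 (x := ⟨_, hu⟩) (y := graphToDomain A† u) rfl).symm
    rw [h1, ← apply_graphToDomain A† v]
    have := LinearPMap.adjoint_isFormalAdjoint Bt.dense_domain (graphToDomain A† v) ⟨_, hu⟩
    rw [← inner_conj_symm, ← inner_conj_symm (graphEmb A† u)]
    exact congrArg conj this.symm
  obtain ⟨v, h0, h1⟩ := Bt.hat_surjective (Bt.hatΓ₁ u) 0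
  obtain ⟨w, k0, k1⟩ := Bt.hat_surjective 0 (Bt.hatΓ₀ u)
  have e1 := key v
  have e2 := key w
  rw [h0, h1, inner_zero_right, sub_zero] at e1
  rw [k0, k1, inner_zero_right, zero_sub, neg_eq_zero] at e2
  exact ⟨inner_self_eq_zero.1 e2, inner_self_eq_zero.1 e1⟩

/-- The resolvent estimate for `A₀`: by Green's identity `⟪f, A₀ f⟫` is real. -/
theorem norm_graphEmb_le_of_ker {u : graphSpace A†} (hu : Bt.hatΓ₀ u = 0) (z : ℂ) :
    |z.im| * ‖graphEmb A† u‖ ≤ ‖graphSub A† z u‖ := by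
  rcases eq_or_ne (graphEmb A† u) 0 with h0 | h0
  · rw [h0]; simp
  have hg := Bt.green_hat u u
  rw [hu, inner_zero_left, inner_zero_right, sub_zero, sub_eq_zero] at hg
  have him : (⟪graphEmb A† u, graphVal A† u⟫_ℂ).im = 0 := by
    rw [← inner_conj_symm] at hg
    have := congrArg Complex.im hg
    simp only [Complex.conj_im] at this
    linarith
  have h1 : (⟪graphEmb A† u, graphSub A† z u⟫_ℂ).im = -(z.im * ‖graphEmb A† u‖ ^ 2) := by
    rw [graphSub_apply, inner_sub_right, inner_smul_right, inner_self_eq_norm_sq_to_K,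
      Complex.sub_im, him]
    simp [← Complex.ofReal_pow]
  have h2 := (Complex.abs_im_le_norm _).trans
    (norm_inner_le_norm (𝕜 := ℂ) (graphEmb A† u) (graphSub A† z u))
  rw [h1, abs_neg, abs_mul, abs_of_nonneg (sq_nonneg ‖_‖)] at h2
  have hp : 0 < ‖graphEmb A† u‖ := norm_pos_iff.2 h0
  nlinarith

/-- The resolvent estimate for `A₀`, in the graph norm. -/
theorem norm_le_of_ker {u : graphSpace A†} (hu : Bt.hatΓ₀ u = 0) {z : ℂ} (hz : z.im ≠ 0) :
    ‖u‖ ≤ resBound z * ‖graphSub A† z u‖ := by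
  have h1 := Bt.norm_graphEmb_le_of_ker hu z
  have hp : 0 < |z.im| := abs_pos.2 hz
  have h2 : ‖graphEmb A† u‖ ≤ ‖graphSub A† z u‖ / |z.im| := by
    rw [le_div_iff₀ hp]; linarith
  have h3 : ‖graphVal A† u‖ ≤ ‖graphSub A† z u‖ + ‖z‖ * ‖graphEmb A† u‖ := by
    rw [← norm_smul]
    have : graphVal A† u = graphSub A† z u + z • graphEmb A† u := by rw [graphSub_apply]; abel
    rw [this]; exact norm_add_le _ _
  calc ‖u‖ ≤ ‖graphEmb A† u‖ + ‖graphVal A† u‖ := norm_graphSpace_le _ u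
    _ ≤ ‖graphSub A† z u‖ + (1 + ‖z‖) * ‖graphEmb A† u‖ := by linarith
    _ ≤ ‖graphSub A† z u‖ + (1 + ‖z‖) * (‖graphSub A† z u‖ / |z.im|) := by gcongr
    _ = resBound z * ‖graphSub A† z u‖ := by unfold resBound; ring

/-- The operator `A₀ - z` is surjective for nonreal `z`. Its range is closed by the resolvent
estimate, and a vector orthogonal to the range is an eigenvector of `A₀` for the nonreal
number `conj z`. -/
theorem exists_ker_graphSub_eq {z : ℂ} (hz : z.im ≠ 0) (h : H) :
    ∃ u : graphSpace A†, Bt.hatΓ₀ u = 0 ∧ graphSub A† z u = h := by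
  have := Bt.completeSpace_graphSpace
  set N : Submodule ℂ (graphSpace A†) := LinearMap.ker Bt.hatΓ₀.toLinearMap
  have hN : IsClosed (N : Set (graphSpace A†)) := Bt.hatΓ₀.isClosed_ker
  have : CompleteSpace N := hN.completeSpace_coe
  set D : N →L[ℂ] H := (graphSub A† z).comp N.subtypeL with hD
  have hanti : AntilipschitzWith (Real.toNNReal (resBound z)) D :=
    AddMonoidHomClass.antilipschitz_of_bound D fun u => by
      rw [Real.coe_toNNReal _ (resBound_pos z).le]
      exact Bt.norm_le_of_ker u.2 hz
  have hcl : IsClosed (D.range : Set H) := hanti.isClosed_range D.uniformContinuous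
  have : CompleteSpace D.range := hcl.completeSpace_coe
  have htop : D.range = ⊤ := by
    rw [← Submodule.orthogonal_eq_bot_iff, Submodule.eq_bot_iff]
    intro k hk
    have hk' : ∀ u, Bt.hatΓ₀ u = 0 → ⟪graphSub A† z u, k⟫_ℂ = 0 := fun u hu =>
      (Submodule.mem_orthogonal _ _).1 hk _ ⟨⟨u, hu⟩, rfl⟩
    have hw : ∀ f : A.domain, ⟪conj z • k, (f : H)⟫_ℂ = ⟪k, A f⟫_ℂ := by
      intro f
      set f' : A†.domain := ⟨f, Bt.le_adjoint.1 f.2⟩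
      have hA : A† f' = A f := (Bt.le_adjoint.2 (x := f) (y := f') rfl).symm
      have h1 := hk' (graphMk A† f') (Bt.hat_eq_zero_of_mem (u := graphMk A† f') f.2).1
      rw [graphSub_apply, graphVal_graphMk, graphEmb_graphMk, hA, inner_sub_left, inner_smul_left,
        sub_eq_zero] at h1
      have h2 := congrArg conj h1
      rw [map_mul, inner_conj_symm, inner_conj_symm] at h2
      rw [inner_smul_left, h2]
    have hmem : k ∈ A†.domain := LinearPMap.mem_adjoint_domain_of_exists k ⟨conj z • k, hw⟩
    have hval : A† ⟨k, hmem⟩ = conj z • k := LinearPMap.adjoint_apply_eq Bt.dense_domain _ hw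
    set w := graphMk A† ⟨k, hmem⟩
    -- Green's identity against `u` with `Γ₀ u = 0` and `Γ₁ u = Γ₀ w`.
    have hΓ : Bt.hatΓ₀ w = 0 := by
      obtain ⟨u, hu0, hu1⟩ := Bt.hat_surjective 0 (Bt.hatΓ₀ w)
      have hg := Bt.green_hat u w
      rw [hu0, hu1, inner_zero_left, sub_zero] at hg
      have h1 := hk' u hu0
      rw [graphSub_apply, inner_sub_left, inner_smul_left] at h1
      have h2 : ⟪graphEmb A† u, graphVal A† w⟫_ℂ = conj z * ⟪graphEmb A† u, k⟫_ℂ := by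
        rw [graphVal_graphMk, hval, inner_smul_right]
      rw [h2] at hg
      exact inner_self_eq_zero.1 (hg.symm.trans h1)
    have hz' : (conj z).im ≠ 0 := by simpa using hz
    have h3 := Bt.norm_le_of_ker hΓ hz'
    have h4 : graphSub A† (conj z) w = 0 := by
      rw [graphSub_apply, graphVal_graphMk, hval, graphEmb_graphMk, sub_self]
    rw [h4, norm_zero, mul_zero] at h3
    have h5 : w = 0 := norm_le_zero_iff.1 h3
    have h6 : graphEmb A† w = 0 := by rw [h5, map_zero]
    exact h6
  obtain ⟨u, hu⟩ : h ∈ D.range := by rw [htop]; trivial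
  exact ⟨u, u.2, hu⟩

theorem restrΓ₀_isInvertible {z : ℂ} (hz : z.im ≠ 0) : (Bt.restrΓ₀ z).IsInvertible := by
  have := Bt.completeSpace_graphSpace
  have hcl : IsClosed (graphDefectSpace A z : Set (graphSpace A†)) := (graphSub A† z).isClosed_ker
  have h1 : (Bt.restrΓ₀ z).ker = ⊥ := by
    refine LinearMap.ker_eq_bot'.2 fun u hu => ?_
    have h := Bt.norm_le_of_ker (u := u) hu hz
    have h0 : graphSub A† z u = 0 := u.2
    rw [h0, norm_zero, mul_zero] at h
    exact Subtype.ext (norm_le_zero_iff.1 h)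
  have h2 : (Bt.restrΓ₀ z).range = ⊤ := by
    refine LinearMap.range_eq_top.2 fun g => ?_
    obtain ⟨w, hw, -⟩ := Bt.hat_surjective g 0
    obtain ⟨u, hu, hu'⟩ := Bt.exists_ker_graphSub_eq hz (graphSub A† z w)
    refine ⟨⟨w - u, ?_⟩, ?_⟩
    · change graphSub A† z (w - u) = 0
      rw [map_sub, hu', sub_self]
    · change Bt.hatΓ₀ (w - u) = g
      rw [map_sub, hw, hu, sub_zero]
  exact isInvertible_of_bijective hcl (Bt.restrΓ₀ z) h1 h2

theorem hatΓ₀_gammaHat {z : ℂ} (hz : z.im ≠ 0) (g : G) : Bt.hatΓ₀ (Bt.gammaHat z g) = g :=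
  (Bt.restrΓ₀_isInvertible hz).self_apply_inverse g

theorem graphSub_gammaHat (z : ℂ) (g : G) : graphSub A† z (Bt.gammaHat z g) = 0 :=
  ((Bt.restrΓ₀ z).inverse g).2

/-- An approximate solution `u` of `(A† - z) u = 0` is close to the solution with the same boundary
value `Γ₀ u`. -/
theorem norm_sub_gammaHat_le {z : ℂ} (hz : z.im ≠ 0) (u : graphSpace A†) :
    ‖u - Bt.gammaHat z (Bt.hatΓ₀ u)‖ ≤ resBound z * ‖graphSub A† z u‖ := by
  have h := Bt.norm_le_of_ker (u := u - Bt.gammaHat z (Bt.hatΓ₀ u))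
    (by rw [map_sub, Bt.hatΓ₀_gammaHat hz, sub_self]) hz
  rwa [map_sub, Bt.graphSub_gammaHat, sub_zero] at h

theorem eq_gammaHat {z : ℂ} (hz : z.im ≠ 0) {u : graphSpace A†} (hu : graphSub A† z u = 0) :
    u = Bt.gammaHat z (Bt.hatΓ₀ u) := by
  have h := Bt.norm_sub_gammaHat_le hz u
  rw [hu, norm_zero, mul_zero] at h
  exact sub_eq_zero.1 (norm_le_zero_iff.1 h)

theorem norm_gammaHat_sub_le {z : ℂ} (hz : z.im ≠ 0) {w : ℂ} (hw : w.im ≠ 0) (g : G) :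
    ‖Bt.gammaHat w g - Bt.gammaHat z g‖ ≤ resBound z * (‖w - z‖ * ‖Bt.gammaHat w g‖) := by
  have h := Bt.norm_sub_gammaHat_le hz (Bt.gammaHat w g)
  rw [Bt.hatΓ₀_gammaHat hw] at h
  refine h.trans (mul_le_mul_of_nonneg_left ?_ (resBound_pos z).le)
  have h1 : graphSub A† z (Bt.gammaHat w g) = (w - z) • graphEmb A† (Bt.gammaHat w g) := by
    have h0 := Bt.graphSub_gammaHat w g
    rw [graphSub_apply, sub_eq_zero] at h0
    rw [graphSub_apply, h0, sub_smul]
  rw [h1, norm_smul]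
  exact mul_le_mul_of_nonneg_left (norm_graphEmb_le _ _) (norm_nonneg _)

theorem gammaField_apply (z : ℂ) (g : G) : Bt.gammaField z g = graphEmb A† (Bt.gammaHat z g) := rfl

theorem weyl_apply (z : ℂ) (g : G) : Bt.weyl z g = Bt.hatΓ₁ (Bt.gammaHat z g) := rfl

theorem range_gammaField {z : ℂ} (hz : z.im ≠ 0) :
    LinearMap.range (Bt.gammaField z).toLinearMap = defectSpace A z := by
  ext x
  constructor
  · rintro ⟨g, rfl⟩
    refine ⟨graphToDomain A† (Bt.gammaHat z g), ?_, rfl⟩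
    have h0 := Bt.graphSub_gammaHat z g
    rw [graphSub_apply, ← apply_graphToDomain] at h0
    exact h0
  · rintro ⟨f, hf, rfl⟩
    have h0 : graphSub A† z (graphMk A† f) = 0 := hf
    exact ⟨Bt.Γ₀ f, congrArg (graphEmb A†) (Bt.eq_gammaHat hz h0).symm⟩

/-- Green's identity for two elements of defect subspaces. -/
theorem inner_weyl {z w : ℂ} (hz : z.im ≠ 0) (hw : w.im ≠ 0) (g h : G) :
    ⟪Bt.weyl z g, h⟫_ℂ - ⟪g, Bt.weyl w h⟫_ℂ =
      (conj z - w) * ⟪Bt.gammaField z g, Bt.gammaField w h⟫_ℂ := by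
  have hg := Bt.green_hat (Bt.gammaHat z g) (Bt.gammaHat w h)
  rw [Bt.hatΓ₀_gammaHat hz, Bt.hatΓ₀_gammaHat hw] at hg
  rw [weyl_apply, weyl_apply, ← hg]
  have h1 := Bt.graphSub_gammaHat z g
  have h2 := Bt.graphSub_gammaHat w h
  rw [graphSub_apply, sub_eq_zero] at h1 h2
  rw [h1, h2, inner_smul_left, inner_smul_right, gammaField_apply, gammaField_apply]
  ring

/-- The difference formula for the Weyl function. -/
theorem inner_weyl_sub {z w : ℂ} (hz : z.im ≠ 0) (hw : w.im ≠ 0) (g h : G) :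
    ⟪h, Bt.weyl z g - Bt.weyl w g⟫_ℂ =
      (z - w) * ⟪Bt.gammaField (conj w) h, Bt.gammaField z g⟫_ℂ := by
  have hw' : (conj w).im ≠ 0 := by simpa using hw
  have h1 := Bt.inner_weyl hw' hw h g
  have h2 := Bt.inner_weyl hw' hz h g
  rw [Complex.conj_conj] at h1 h2
  rw [sub_self, zero_mul] at h1
  rw [inner_sub_right]
  linear_combination h1 - h2

theorem continuousAt_gammaField {z : ℂ} (hz : z.im ≠ 0) (g : G) :
    ContinuousAt (fun w => Bt.gammaField w g) z := by
  have hev : ∀ᶠ w : ℂ in nhds z, w.im ≠ 0 :=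
    Complex.continuous_im.continuousAt.eventually_ne hz
  have hc : ContinuousAt resBound z := by
    unfold resBound
    exact continuousAt_const.add ((continuousAt_const.add continuous_norm.continuousAt).div
      (continuous_abs.comp Complex.continuous_im).continuousAt (abs_pos.2 hz).ne')
  have hlim : Filter.Tendsto (fun w => resBound w * (‖z - w‖ * ‖Bt.gammaHat z g‖))
      (nhds z) (nhds 0) := by
    have : ContinuousAt (fun w => resBound w * (‖z - w‖ * ‖Bt.gammaHat z g‖)) z := by
      refine hc.mul (ContinuousAt.mul ?_ continuousAt_const)
      fun_prop
    have h := this.tendsto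
    rwa [sub_self, norm_zero, zero_mul, mul_zero] at h
  refine tendsto_iff_norm_sub_tendsto_zero.2 (squeeze_zero' (Filter.Eventually.of_forall
    fun _ => norm_nonneg _) ?_ hlim)
  filter_upwards [hev] with w hw
  rw [gammaField_apply, gammaField_apply, ← map_sub, ← norm_neg, ← map_neg, neg_sub]
  exact (norm_graphEmb_le _ _).trans (Bt.norm_gammaHat_sub_le hw hz g)

/-- The matrix elements of the Weyl function are holomorphic off the real axis. -/
theorem hasDerivAt_inner_weyl {z : ℂ} (hz : z.im ≠ 0) (g h : G) :
    HasDerivAt (fun w => ⟪h, Bt.weyl w g⟫_ℂ)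
      ⟪Bt.gammaField (conj z) h, Bt.gammaField z g⟫_ℂ z := by
  rw [hasDerivAt_iff_tendsto_slope]
  have hc : ContinuousAt (fun w => ⟪Bt.gammaField (conj z) h, Bt.gammaField w g⟫_ℂ) z :=
    continuousAt_const.inner (𝕜 := ℂ) (Bt.continuousAt_gammaField hz g)
  refine (hc.tendsto.mono_left nhdsWithin_le_nhds).congr' ?_
  have hev : ∀ᶠ w : ℂ in nhds z, w.im ≠ 0 :=
    Complex.continuous_im.continuousAt.eventually_ne hz
  filter_upwards [nhdsWithin_le_nhds hev, self_mem_nhdsWithin] with w hw hne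
  rw [slope_def_field, ← inner_sub_right, Bt.inner_weyl_sub hw hz,
    mul_div_cancel_left₀ _ (sub_ne_zero.2 hne)]

/-- The `γ`-field is locally bounded in the graph norm, by comparison with its value at `i`. -/
theorem norm_gammaHat_le {z : ℂ} (hz : z.im ≠ 0) :
    ‖Bt.gammaHat z‖ ≤
      (1 + resBound z * ‖Complex.I - z‖) * ‖Bt.gammaHat Complex.I‖ := by
  have h0 := resBound_pos z
  refine ContinuousLinearMap.opNorm_le_bound _ (by positivity) fun g => ?_
  have h1 := Bt.norm_gammaHat_sub_le hz (w := Complex.I) (by simp) g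
  have h2 : ‖Bt.gammaHat z g‖ ≤ ‖Bt.gammaHat Complex.I g‖ +
      ‖Bt.gammaHat Complex.I g - Bt.gammaHat z g‖ := by
    have := norm_sub_le (Bt.gammaHat Complex.I g) (Bt.gammaHat Complex.I g - Bt.gammaHat z g)
    simpa using this
  calc ‖Bt.gammaHat z g‖ ≤ (1 + resBound z * ‖Complex.I - z‖) * ‖Bt.gammaHat Complex.I g‖ := by
        linarith
    _ ≤ (1 + resBound z * ‖Complex.I - z‖) * (‖Bt.gammaHat Complex.I‖ * ‖g‖) := by
        gcongr; exact ContinuousLinearMap.le_opNorm _ _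
    _ = _ := by ring

/-- The Weyl function is of scalar type if the deficiency indices are equal to one: then the
boundary space is a line. -/
theorem exists_isScalarType (hA : Module.finrank ℂ (defectSpace A Complex.I) = 1) :
    ∃ m, Bt.IsScalarType m := by
  have hI : (Complex.I).im ≠ 0 := by simp
  have hG : Module.finrank ℂ G = 1 := by
    have hinj : Function.Injective (Bt.gammaField Complex.I).toLinearMap := by
      intro g g' h
      have := graphEmb_injective A† h
      exact (Bt.hatΓ₀_gammaHat hI g).symm.trans
        ((congrArg Bt.hatΓ₀ this).trans (Bt.hatΓ₀_gammaHat hI g'))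
    rw [← hA, ← Bt.range_gammaField hI]
    exact (LinearEquiv.ofInjective _ hinj).finrank_eq
  obtain ⟨e, he⟩ : ∃ e : G, ‖e‖ = 1 := by
    have : Nontrivial G := Module.nontrivial_of_finrank_pos (R := ℂ) (by omega)
    obtain ⟨x, hx⟩ := exists_ne (0 : G)
    exact ⟨_, norm_smul_inv_norm (𝕜 := ℂ) hx⟩
  have he0 : e ≠ 0 := norm_pos_iff.1 (he ▸ one_pos)
  have hee : ⟪e, e⟫_ℂ = 1 := by rw [inner_self_eq_norm_sq_to_K, he]; simp
  have hW : ∀ z, Bt.weyl z = ⟪e, Bt.weyl z e⟫_ℂ • ContinuousLinearMap.id ℂ G := by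
    intro z
    have hs : ∀ x : G, ∃ c : ℂ, c • e = x := (finrank_eq_one_iff_of_nonzero' e he0).1 hG
    obtain ⟨c, hc⟩ := hs (Bt.weyl z e)
    ext x
    obtain ⟨d, rfl⟩ := hs x
    rw [← hc, inner_smul_right, hee, mul_one, map_smul, ← hc]
    exact smul_comm _ _ _
  refine ⟨fun z => ⟪e, Bt.weyl z e⟫_ℂ, ⟨fun z hz =>
    (Bt.hasDerivAt_inner_weyl hz e e).differentiableAt.differentiableWithinAt,
    fun z hz => ⟨?_, ?_⟩⟩, fun z _ => hW z⟩
  · have hz' : (conj z).im ≠ 0 := by simpa using hz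
    have := Bt.inner_weyl hz hz' e e
    rw [sub_self, zero_mul, sub_eq_zero] at this
    simp only [← this, inner_conj_symm]
  · have h := Bt.inner_weyl hz hz e e
    rw [← inner_conj_symm, inner_self_eq_norm_sq_to_K] at h
    have him := congrArg Complex.im h
    have h2 : ((conj z - z) * (((‖Bt.gammaField z e‖ : ℝ) : ℂ)) ^ 2).im =
        -2 * z.im * ‖Bt.gammaField z e‖ ^ 2 := by
      rw [← Complex.ofReal_pow, Complex.mul_im, Complex.ofReal_re, Complex.ofReal_im,
        Complex.sub_im, Complex.conj_im]
      ring
    have h3 := him.trans h2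
    rw [Complex.sub_im, Complex.conj_im] at h3
    have h4 : (⟪e, Bt.weyl z e⟫_ℂ).im = z.im * ‖Bt.gammaField z e‖ ^ 2 := by linarith
    rw [h4, mul_div_cancel_left₀ _ hz]
    positivity

end BoundaryTriplet

/-! ### Extension of identities from elementary tensors -/

section HTensorMore

variable {H K : Type*}
  [NormedAddCommGroup H] [InnerProductSpace ℂ H] [NormedAddCommGroup K] [InnerProductSpace ℂ K]

/-- A closed additive property of vectors in the Hilbert space tensor product holds everywhere if it
holds for elementary tensors. -/
theorem htensor_induction {p : HTensor H K → Prop} (hc : IsClosed {u | p u})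
    (ht : ∀ x y, p (htmul x y)) (hadd : ∀ u v, p u → p v → p (u + v)) (u : HTensor H K) : p u := by
  induction u using UniformSpace.Completion.induction_on with
  | hp => exact hc
  | ih a =>
    induction a with
    | zero =>
      have := ht 0 0
      rwa [htmul, TensorProduct.zero_tmul] at this
    | tmul x y => exact ht x y
    | add a b ha hb => rw [UniformSpace.Completion.coe_add]; exact hadd _ _ ha hb

theorem mem_of_htmul_mem {E : Type*} [NormedAddCommGroup E] [NormedSpace ℂ E]
    (L : HTensor H K →L[ℂ] E) {N : Submodule ℂ E} (hN : IsClosed (N : Set E))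
    (h : ∀ x y, L (htmul x y) ∈ N) (u : HTensor H K) : L u ∈ N :=
  htensor_induction (p := fun u => L u ∈ N) (hN.preimage L.continuous) h
    (fun u v hu hv => by rw [map_add]; exact add_mem hu hv) u

theorem inner_tensorMap_htmul {E : Type*} [NormedAddCommGroup E] [InnerProductSpace ℂ E]
    {X : H →L[ℂ] E} {c : E} {d : H} (h : ∀ a, ⟪X a, c⟫_ℂ = ⟪a, d⟫_ℂ) (k : K) (x : HTensor H K) :
    ⟪tensorMap X (ContinuousLinearMap.id ℂ K) x, htmul c k⟫_ℂ = ⟪x, htmul d k⟫_ℂ := by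
  refine htensor_induction (p := fun x => ⟪tensorMap X (ContinuousLinearMap.id ℂ K) x,
    htmul c k⟫_ℂ = ⟪x, htmul d k⟫_ℂ) (isClosed_eq (by fun_prop) (by fun_prop))
    (fun a b => ?_) (fun u v hu hv => ?_) x
  · rw [tensorMap_htmul, inner_htmul, inner_htmul, h]; rfl
  · rw [map_add, inner_add_left, inner_add_left, hu, hv]

/-- Green's identity for a tensor product with `I ⊗ T` added; the terms with `T` cancel. -/
theorem green_tensorMap {E F : Type*} [NormedAddCommGroup E] [InnerProductSpace ℂ E]
    [NormedAddCommGroup F] [InnerProductSpace ℂ F] {J V : E →L[ℂ] H} {Γ₀ Γ₁ : E →L[ℂ] F}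
    {T : K →L[ℂ] K}
    (h : ∀ a b, ⟪V a, J b⟫_ℂ - ⟪J a, V b⟫_ℂ = ⟪Γ₁ a, Γ₀ b⟫_ℂ - ⟪Γ₀ a, Γ₁ b⟫_ℂ)
    (hT : ∀ a b, ⟪T a, b⟫_ℂ = ⟪a, T b⟫_ℂ) {j w : HTensor E K →L[ℂ] HTensor H K}
    {g₀ g₁ : HTensor E K →L[ℂ] HTensor F K}
    (hj : ∀ a k, j (htmul a k) = htmul (J a) k)
    (hw : ∀ a k, w (htmul a k) = htmul (V a) k + htmul (J a) (T k))
    (h₀ : ∀ a k, g₀ (htmul a k) = htmul (Γ₀ a) k) (h₁ : ∀ a k, g₁ (htmul a k) = htmul (Γ₁ a) k)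
    (u v : HTensor E K) :
    ⟪w u, j v⟫_ℂ - ⟪j u, w v⟫_ℂ = ⟪g₁ u, g₀ v⟫_ℂ - ⟪g₀ u, g₁ v⟫_ℂ := by
  refine htensor_induction (p := fun u => ⟪w u, j v⟫_ℂ - ⟪j u, w v⟫_ℂ =
    ⟪g₁ u, g₀ v⟫_ℂ - ⟪g₀ u, g₁ v⟫_ℂ) (isClosed_eq (by fun_prop) (by fun_prop))
    (fun a k => ?_) (fun u u' hu hu' => ?_) u
  · refine htensor_induction (p := fun v => ⟪w (htmul a k), j v⟫_ℂ - ⟪j (htmul a k), w v⟫_ℂ =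
      ⟪g₁ (htmul a k), g₀ v⟫_ℂ - ⟪g₀ (htmul a k), g₁ v⟫_ℂ)
      (isClosed_eq (by fun_prop) (by fun_prop)) (fun b l => ?_) (fun v v' hv hv' => ?_) v
    · simp only [hj, hw, h₀, h₁, inner_add_left, inner_add_right, inner_htmul, hT]
      linear_combination ⟪k, l⟫_ℂ * h a b
    · simp only [map_add, inner_add_right]
      linear_combination hv + hv'
  · simp only [map_add, inner_add_left]
    linear_combination hu + hu'

/-- If `Γ` has a bounded right inverse, then `ker (Γ ⊗ I)` is the closure of the algebraic tensor
product of `ker Γ` with `K`: the operator `I - R Γ` is a bounded projection onto `ker Γ`. -/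
theorem mem_of_tensorMap_eq_zero {E F X : Type*} [NormedAddCommGroup E] [InnerProductSpace ℂ E]
    [NormedAddCommGroup F] [InnerProductSpace ℂ F] [NormedAddCommGroup X] [NormedSpace ℂ X]
    {Γ : E →L[ℂ] F} {R : F →L[ℂ] E} (hR : ∀ x, Γ (R x) = x) (L : HTensor E K →L[ℂ] X)
    {N : Submodule ℂ X} (hN : IsClosed (N : Set X))
    (h : ∀ w, Γ w = 0 → ∀ k, L (htmul w k) ∈ N) {u : HTensor E K}
    (hu : tensorMap Γ (ContinuousLinearMap.id ℂ K) u = 0) : L u ∈ N := by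
  set Q : E →L[ℂ] E := ContinuousLinearMap.id ℂ E - R.comp Γ with hQ
  have hQu : tensorMap Q (ContinuousLinearMap.id ℂ K) u = u := by
    have : tensorMap (R.comp Γ) (ContinuousLinearMap.id ℂ K) u =
        tensorMap R (ContinuousLinearMap.id ℂ K) (tensorMap Γ (ContinuousLinearMap.id ℂ K) u) := by
      rw [tensorMap_tensorMap, ContinuousLinearMap.comp_id]
    rw [hQ, tensorMap_sub_left, tensorMap_id]
    change u - tensorMap (R.comp Γ) _ u = u
    rw [this, hu, map_zero, sub_zero]
  rw [← hQu]
  refine mem_of_htmul_mem (L.comp (tensorMap Q (ContinuousLinearMap.id ℂ K))) hN (fun w k => ?_) u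
  have hw : Γ (Q w) = 0 := by
    change Γ (w - R (Γ w)) = 0
    rw [map_sub, hR, sub_self]
  have := h (Q w) hw k
  change L (tensorMap Q _ (htmul w k)) ∈ N
  rw [tensorMap_htmul]
  exact this

end HTensorMore

/-! ### The operator `B ⊗ I + I ⊗ T` -/

section AlgTensorSum

variable {H K : Type*}
  [NormedAddCommGroup H] [InnerProductSpace ℂ H] [NormedAddCommGroup K] [InnerProductSpace ℂ K]
  {B : H →ₗ.[ℂ] H} {T : K →L[ℂ] K}

theorem algTensorSum_apply (u : B.domain ⊗[ℂ] K) :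
    algTensorSum B T ⟨algIncl B K u, ⟨u, rfl⟩⟩ =
      ((B.toFun.rTensor K u + TensorProduct.map B.domain.subtype T.toLinearMap u : H ⊗[ℂ] K) :
        HTensor H K) := by
  have : (LinearEquiv.ofInjective (algIncl B K) (algIncl_injective B)).symm
      ⟨algIncl B K u, ⟨u, rfl⟩⟩ = u :=
    (LinearEquiv.symm_apply_eq _).2 rfl
  exact congrArg (fun v => UniformSpace.Completion.toComplL (𝕜 := ℂ) ((B.toFun.rTensor K +
    TensorProduct.map B.domain.subtype T.toLinearMap) v)) this

theorem mem_graph_algTensorSum (B : H →ₗ.[ℂ] H) (T : K →L[ℂ] K) (f : B.domain) (y : K) :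
    (htmul (f : H) y, htmul (B f) y + htmul (f : H) (T y)) ∈ (algTensorSum B T).graph := by
  rw [LinearPMap.mem_graph_iff]
  refine ⟨⟨algIncl B K (f ⊗ₜ y), ⟨_, rfl⟩⟩, rfl, ?_⟩
  rw [algTensorSum_apply]
  exact UniformSpace.Completion.coe_add _ _

theorem graph_algTensorSum_le {M : Submodule ℂ (HTensor H K × HTensor H K)}
    (h : ∀ (f : B.domain) (y : K), (htmul (f : H) y, htmul (B f) y + htmul (f : H) (T y)) ∈ M) :
    (algTensorSum B T).graph ≤ M := by
  rintro ⟨x, x'⟩ hx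
  rw [LinearPMap.mem_graph_iff] at hx
  obtain ⟨⟨_, ⟨u, rfl⟩⟩, rfl, rfl⟩ := hx
  simp only
  induction u with
  | zero =>
    have := M.zero_mem
    have h0 : (⟨algIncl B K 0, ⟨0, rfl⟩⟩ : (algTensorSum B T).domain) = 0 :=
      Subtype.ext (map_zero _)
    rw [h0, LinearPMap.map_zero, map_zero]
    exact this
  | tmul f y =>
    have h1 := h f y
    rw [algTensorSum_apply]
    have e : ((B.toFun.rTensor K (f ⊗ₜ y) + TensorProduct.map B.domain.subtype T.toLinearMap
        (f ⊗ₜ y) : H ⊗[ℂ] K) : HTensor H K) = htmul (B f) y + htmul (f : H) (T y) :=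
      UniformSpace.Completion.coe_add _ _
    rw [e]
    exact h1
  | add u v hu hv =>
    have h0 : (⟨algIncl B K (u + v), ⟨u + v, rfl⟩⟩ : (algTensorSum B T).domain) =
        ⟨algIncl B K u, ⟨u, rfl⟩⟩ + ⟨algIncl B K v, ⟨v, rfl⟩⟩ :=
      Subtype.ext (map_add _ _ _)
    rw [h0, LinearPMap.map_add, map_add]
    exact M.add_mem hu hv

theorem dense_domain_algTensorSum (hB : Dense (B.domain : Set H)) :
    Dense ((algTensorSum B T).domain : Set (HTensor H K)) := by
  set N := (algTensorSum B T).domain.topologicalClosure with hN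
  have hNc : IsClosed (N : Set (HTensor H K)) := Submodule.isClosed_topologicalClosure _
  have h1 : ∀ x y, htmul x y ∈ N := by
    intro x y
    have hc : IsClosed {x : H | htmul x y ∈ N} :=
      hNc.preimage (continuous_htmul.comp (continuous_id.prodMk continuous_const))
    refine closure_minimal (fun f hf => ?_) hc (hB x)
    exact Submodule.le_topologicalClosure _
      (LinearPMap.mem_domain_of_mem_graph (mem_graph_algTensorSum B T ⟨f, hf⟩ y))
  intro u
  exact mem_of_htmul_mem (ContinuousLinearMap.id ℂ _) hNc h1 u

theorem dense_domain_tensorSum (hB : Dense (B.domain : Set H)) :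
    Dense ((tensorSum B T).domain : Set (HTensor H K)) :=
  (dense_domain_algTensorSum hB).mono (algTensorSum B T).le_closure.1

end AlgTensorSum

/-! ### The adjoint of `A ⊗ I + I ⊗ T` -/

section DirectSum

variable {H : Type*} [NormedAddCommGroup H] [InnerProductSpace ℂ H]

/-- The inclusion of `H` as the first summand of `H ⊕ H`. -/
def inlL (H : Type*) [NormedAddCommGroup H] [InnerProductSpace ℂ H] : H →L[ℂ] WithLp 2 (H × H) :=
  (WithLp.prodContinuousLinearEquiv 2 ℂ H H).symm.toContinuousLinearMap.comp
    (ContinuousLinearMap.inl ℂ H H)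

/-- The inclusion of `H` as the second summand of `H ⊕ H`. -/
def inrL (H : Type*) [NormedAddCommGroup H] [InnerProductSpace ℂ H] : H →L[ℂ] WithLp 2 (H × H) :=
  (WithLp.prodContinuousLinearEquiv 2 ℂ H H).symm.toContinuousLinearMap.comp
    (ContinuousLinearMap.inr ℂ H H)

theorem inner_inlL (x : H) (c : WithLp 2 (H × H)) : ⟪inlL H x, c⟫_ℂ = ⟪x, c.fst⟫_ℂ := by
  rw [WithLp.prod_inner_apply]
  change ⟪x, _⟫_ℂ + ⟪(0 : H), _⟫_ℂ = _
  rw [inner_zero_left, add_zero]; rfl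

theorem inner_inrL (x : H) (c : WithLp 2 (H × H)) : ⟪inrL H x, c⟫_ℂ = ⟪x, c.snd⟫_ℂ := by
  rw [WithLp.prod_inner_apply]
  change ⟪(0 : H), _⟫_ℂ + ⟪x, _⟫_ℂ = _
  rw [inner_zero_left, zero_add]; rfl

end DirectSum

section AdjointOfTensorSum

variable {H K : Type*}
  [NormedAddCommGroup H] [InnerProductSpace ℂ H] [CompleteSpace H]
  [NormedAddCommGroup K] [InnerProductSpace ℂ K]

theorem mem_graph_adjoint_iff {E : Type*} [NormedAddCommGroup E] [InnerProductSpace ℂ E]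
    [CompleteSpace E] {B : E →ₗ.[ℂ] E} (hB : Dense (B.domain : Set E)) (x y : E) :
    (x, y) ∈ B†.graph ↔ ∀ p ∈ B.graph, ⟪p.2, x⟫_ℂ = ⟪p.1, y⟫_ℂ := by
  rw [LinearPMap.adjoint_graph_eq_graph_adjoint hB, Submodule.mem_adjoint_iff]
  simp only [Prod.forall, sub_eq_zero]

/-- The pairs `(a, b)` with `⟪b, x⟫ = ⟪a, y⟫`. The pair `(x, y)` belongs to the graph of the adjoint
of `B` if this subspace contains the graph of `B`. -/
def adjointTest {E : Type*} [NormedAddCommGroup E] [InnerProductSpace ℂ E] (x y : E) :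
    Submodule ℂ (E × E) where
  carrier := {p | ⟪x, p.2⟫_ℂ = ⟪y, p.1⟫_ℂ}
  add_mem' {p q} (hp : ⟪x, p.2⟫_ℂ = ⟪y, p.1⟫_ℂ) (hq : ⟪x, q.2⟫_ℂ = ⟪y, q.1⟫_ℂ) := by
    simp [hp, hq]
  zero_mem' := by simp
  smul_mem' c p (hp : ⟪x, p.2⟫_ℂ = ⟪y, p.1⟫_ℂ) := by simp [hp]

theorem isClosed_adjointTest {E : Type*} [NormedAddCommGroup E] [InnerProductSpace ℂ E] (x y : E) :
    IsClosed (adjointTest x y : Set (E × E)) :=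
  isClosed_eq (f := fun p : E × E => ⟪x, p.2⟫_ℂ) (by fun_prop) (by fun_prop)

/-- The embedding `J ⊗ I` of `dom A† ⊗ K`, with the graph norm on `dom A†`, into `H ⊗ K`. -/
noncomputable def sumEmb (A : H →ₗ.[ℂ] H) (K : Type*) [NormedAddCommGroup K]
    [InnerProductSpace ℂ K] : HTensor (graphSpace A†) K →L[ℂ] HTensor H K :=
  tensorMap (graphEmb A†) (ContinuousLinearMap.id ℂ K)

/-- The operator `A† ⊗ I + I ⊗ T` on `dom A† ⊗ K`, with the graph norm on `dom A†`. -/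
noncomputable def sumVal (A : H →ₗ.[ℂ] H) (T : K →L[ℂ] K) :
    HTensor (graphSpace A†) K →L[ℂ] HTensor H K :=
  tensorMap (graphVal A†) (ContinuousLinearMap.id ℂ K) + tensorMap (graphEmb A†) T

@[simp] theorem sumEmb_htmul (A : H →ₗ.[ℂ] H) (v : graphSpace A†) (y : K) :
    sumEmb A K (htmul v y) = htmul (graphEmb A† v) y := by simp [sumEmb]

@[simp] theorem sumVal_htmul (A : H →ₗ.[ℂ] H) (T : K →L[ℂ] K) (v : graphSpace A†) (y : K) :
    sumVal A T (htmul v y) = htmul (graphVal A† v) y + htmul (graphEmb A† v) (T y) := by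
  simp [sumVal]

/-- The rotated graph `{(-A f, f)}` of `A`, as a subspace of `H ⊕ H`. -/
def rotatedGraph (A : H →ₗ.[ℂ] H) : Submodule ℂ (WithLp 2 (H × H)) :=
  LinearMap.range ((inrL H).toLinearMap ∘ₗ A.domain.subtype - (inlL H).toLinearMap ∘ₗ A.toFun)

theorem orthogonal_rotatedGraph {A : H →ₗ.[ℂ] H} (hA : Dense (A.domain : Set H)) :
    (rotatedGraph A)ᗮ = graphSpace A† := by
  ext w
  have h1 : w ∈ graphSpace A† ↔ (w.fst, w.snd) ∈ A†.graph := Iff.rfl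
  rw [h1, mem_graph_adjoint_iff hA, Submodule.mem_orthogonal]
  have h2 : ∀ f : A.domain, ⟪inrL H (f : H) - inlL H (A f), w⟫_ℂ = 0 ↔
      ⟪A f, w.fst⟫_ℂ = ⟪(f : H), w.snd⟫_ℂ := by
    intro f
    rw [inner_sub_left, inner_inrL, inner_inlL, sub_eq_zero, eq_comm]
  constructor
  · rintro h ⟨_, _⟩ hp
    rw [LinearPMap.mem_graph_iff] at hp
    obtain ⟨f, rfl, rfl⟩ := hp
    exact (h2 f).1 (h _ ⟨f, rfl⟩)
  · rintro h _ ⟨f, rfl⟩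
    exact (h2 f).2 (h _ (A.mem_graph f))

variable [CompleteSpace K]

theorem graph_algTensorSum_le_adjointTest {A : H →ₗ.[ℂ] H} (hA : Dense (A.domain : Set H))
    {T : K →L[ℂ] K} (hT : IsSelfAdjoint T) (u : HTensor (graphSpace A†) K) :
    (algTensorSum A T).graph ≤ adjointTest (sumEmb A K u) (sumVal A T u) := by
  have hTs : ∀ a b : K, ⟪T a, b⟫_ℂ = ⟪a, T b⟫_ℂ :=
    ContinuousLinearMap.isSelfAdjoint_iff_isSymmetric.1 hT
  refine graph_algTensorSum_le fun f k => ?_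
  change ⟪sumEmb A K u, htmul (A f) k + htmul (f : H) (T k)⟫_ℂ =
    ⟪sumVal A T u, htmul (f : H) k⟫_ℂ
  refine htensor_induction (p := fun u => ⟪sumEmb A K u, htmul (A f) k + htmul (f : H) (T k)⟫_ℂ =
    ⟪sumVal A T u, htmul (f : H) k⟫_ℂ) (isClosed_eq (by fun_prop) (by fun_prop))
    (fun v l => ?_) (fun u v hu hv => ?_) u
  · have hv := LinearPMap.adjoint_isFormalAdjoint hA (graphToDomain A† v) f
    rw [apply_graphToDomain] at hv
    change _ = ⟪graphEmb A† v, _⟫_ℂ at hv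
    rw [sumEmb_htmul, sumVal_htmul, inner_add_right, inner_add_left, inner_htmul, inner_htmul,
      inner_htmul, inner_htmul, hv, hTs]
  · rw [map_add, map_add, inner_add_left, inner_add_left, hu, hv]

/-- The graph of the adjoint of `A ⊙ I + I ⊙ T`. The orthogonal complement in `(H ⊕ H) ⊗ K` of the
tensor product of the rotated graph of `A` with `K` is the tensor product of the graph of `A†`
with `K`. -/
theorem mem_graph_adjoint_algTensorSum {A : H →ₗ.[ℂ] H} (hA : Dense (A.domain : Set H))
    {T : K →L[ℂ] K} (hT : IsSelfAdjoint T) (x y : HTensor H K) :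
    (x, y) ∈ (algTensorSum A T)†.graph ↔ ∃ u, sumEmb A K u = x ∧ sumVal A T u = y := by
  rw [mem_graph_adjoint_iff (dense_domain_algTensorSum hA)]
  constructor
  · intro h
    have hgc : IsClosed (graphSpace A† : Set (WithLp 2 (H × H))) := by
      rw [← orthogonal_rotatedGraph hA]; exact Submodule.isClosed_orthogonal _
    have : CompleteSpace (graphSpace A†) := hgc.completeSpace_coe
    set y' := y - tensorMap (ContinuousLinearMap.id ℂ H) T x with hy'
    set w := tensorMap (inlL H) (ContinuousLinearMap.id ℂ K) x +
      tensorMap (inrL H) (ContinuousLinearMap.id ℂ K) y' with hw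
    set P := (graphSpace A†).starProjection with hP
    -- The vector `w = (x, y - (I ⊗ T) x)` of `(H ⊕ H) ⊗ K` is orthogonal to `(graphSpace A†)ᗮ ⊗ K`.
    have inner_w : ∀ c k, ⟪w, htmul c k⟫_ℂ = ⟪x, htmul c.fst k⟫_ℂ + ⟪y', htmul c.snd k⟫_ℂ := by
      intro c k
      rw [hw, inner_add_left, inner_tensorMap_htmul (fun a => inner_inlL a c),
        inner_tensorMap_htmul (fun a => inner_inrL a c)]
    have hQ0 : ∀ c ∈ (graphSpace A†)ᗮ, ∀ k, ⟪w, htmul c k⟫_ℂ = 0 := by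
      intro c hc k
      rw [← orthogonal_rotatedGraph hA, Submodule.orthogonal_orthogonal_eq_closure] at hc
      have hcl : IsClosed {c : WithLp 2 (H × H) | ⟪w, htmul c k⟫_ℂ = 0} :=
        isClosed_eq (continuous_const.inner
          (continuous_htmul.comp (continuous_id.prodMk continuous_const))) continuous_const
      refine closure_minimal ?_ hcl hc
      rintro _ ⟨f, rfl⟩
      have hp := h _ (mem_graph_algTensorSum A T f k)
      simp only at hp
      change ⟪w, htmul (inrL H (f : H) - inlL H (A f)) k⟫_ℂ = 0
      rw [inner_w]
      have e1 : (inrL H (f : H) - inlL H (A f)).fst = -(A f) := by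
        change (0 : H) - A f = _; simp
      have e2 : (inrL H (f : H) - inlL H (A f)).snd = f := by
        change (f : H) - 0 = _; simp
      have e3 : htmul (-(A f)) k = -htmul (A f) k := by
        simpa using htmul_smul_left (-1) (A f) k
      have e4 : ⟪tensorMap (ContinuousLinearMap.id ℂ H) T x, htmul (f : H) k⟫_ℂ =
          ⟪x, htmul (f : H) (T k)⟫_ℂ := by
        have := ContinuousLinearMap.adjoint_inner_right
          (tensorMap (ContinuousLinearMap.id ℂ H) T) x (htmul (f : H) k)
        rw [adjoint_tensorMap, tensorMap_htmul, hT.adjoint_eq, ContinuousLinearMap.adjoint_id]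
          at this
        exact this.symm
      rw [e1, e2, e3, inner_neg_right, hy', inner_sub_left, e4]
      have hp' := congrArg conj hp
      rw [inner_conj_symm, inner_conj_symm, inner_add_right] at hp'
      linear_combination -hp'
    -- Hence `w` belongs to `(graphSpace A†) ⊗ K`.
    set u := tensorMap (graphSpace A†).orthogonalProjectionOnto (ContinuousLinearMap.id ℂ K) w
      with hu
    have hιu : tensorMap (graphSpace A†).subtypeL (ContinuousLinearMap.id ℂ K) u = w := by
      rw [hu, tensorMap_tensorMap, ← sub_eq_zero]
      refine eq_zero_of_inner_htmul fun c k => ?_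
      have hPadj : ContinuousLinearMap.adjoint ((graphSpace A†).subtypeL.comp
          (graphSpace A†).orthogonalProjectionOnto) = P :=
        (isSelfAdjoint_starProjection (graphSpace A†)).adjoint_eq
      rw [inner_sub_left, ← ContinuousLinearMap.adjoint_inner_right, adjoint_tensorMap,
        tensorMap_htmul, hPadj, ContinuousLinearMap.comp_id, ContinuousLinearMap.adjoint_id,
        ← inner_sub_right]
      have e : htmul (P c) ((ContinuousLinearMap.id ℂ K) k) - htmul c k =
          -htmul (c - P c) k := by
        have := htmul_add_left (c - P c) (P c) k
        rw [sub_add_cancel] at this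
        rw [this]
        simp
      rw [e, inner_neg_right, hQ0 _ (Submodule.sub_starProjection_mem_orthogonal c), neg_zero]
    clear_value u
    have hx : sumEmb A K u = x := by
      have h1 : tensorMap (WithLp.fstL 2 ℂ H H) (ContinuousLinearMap.id ℂ K) w = x := by
        rw [hw, map_add, tensorMap_tensorMap, tensorMap_tensorMap]
        have a1 : (WithLp.fstL 2 ℂ H H).comp (inlL H) = ContinuousLinearMap.id ℂ H := rfl
        have a2 : (WithLp.fstL 2 ℂ H H).comp (inrL H) = 0 := rfl
        rw [a1, a2, ContinuousLinearMap.comp_id, tensorMap_id, tensorMap_zero_left]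
        simp
      rw [← h1, ← hιu, tensorMap_tensorMap]; rfl
    have hy : tensorMap (graphVal A†) (ContinuousLinearMap.id ℂ K) u = y' := by
      have h1 : tensorMap (WithLp.sndL 2 ℂ H H) (ContinuousLinearMap.id ℂ K) w = y' := by
        rw [hw, map_add, tensorMap_tensorMap, tensorMap_tensorMap]
        have a1 : (WithLp.sndL 2 ℂ H H).comp (inrL H) = ContinuousLinearMap.id ℂ H := rfl
        have a2 : (WithLp.sndL 2 ℂ H H).comp (inlL H) = 0 := rfl
        rw [a1, a2, ContinuousLinearMap.comp_id, tensorMap_id, tensorMap_zero_left]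
        simp
      rw [← h1, ← hιu, tensorMap_tensorMap]; rfl
    refine ⟨u, hx, ?_⟩
    have h3 : tensorMap (graphEmb A†) T u = tensorMap (ContinuousLinearMap.id ℂ H) T x := by
      rw [← hx, sumEmb, tensorMap_tensorMap]; rfl
    change tensorMap (graphVal A†) (ContinuousLinearMap.id ℂ K) u + tensorMap (graphEmb A†) T u = y
    rw [hy, h3, hy', sub_add_cancel]
  · rintro ⟨u, rfl, rfl⟩ p hp
    have : ⟪sumEmb A K u, p.2⟫_ℂ = ⟪sumVal A T u, p.1⟫_ℂ :=
      graph_algTensorSum_le_adjointTest hA hT u hp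
    rw [← inner_conj_symm, this, inner_conj_symm]

end AdjointOfTensorSum

/-! ### The tensor product of a boundary triplet with the identity -/

section Adjoints

variable {E : Type*} [NormedAddCommGroup E] [InnerProductSpace ℂ E] [CompleteSpace E]

theorem mem_graph_adjoint_iff_le {B : E →ₗ.[ℂ] E} (hB : Dense (B.domain : Set E)) (x y : E) :
    (x, y) ∈ B†.graph ↔ B.graph ≤ adjointTest x y := by
  rw [mem_graph_adjoint_iff hB]
  refine forall₂_congr fun p _ => ?_
  change _ ↔ ⟪x, p.2⟫_ℂ = ⟪y, p.1⟫_ℂ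
  rw [← inner_conj_symm, ← inner_conj_symm p.1]
  exact (starRingEnd ℂ).injective.eq_iff

theorem adjoint_closure {B : E →ₗ.[ℂ] E} (hB : Dense (B.domain : Set E)) (hc : B.IsClosable) :
    B.closure† = B† := by
  have hB' : Dense (B.closure.domain : Set E) := hB.mono B.le_closure.1
  refine LinearPMap.eq_of_eq_graph ?_
  ext ⟨x, y⟩
  rw [mem_graph_adjoint_iff_le hB, mem_graph_adjoint_iff_le hB',
    ← hc.graph_closure_eq_closure_graph]
  exact ⟨fun h => (Submodule.le_topologicalClosure _).trans h,
    fun h => Submodule.topologicalClosure_minimal _ h (isClosed_adjointTest x y)⟩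

theorem isFormalAdjoint_of_le_adjoint {B : E →ₗ.[ℂ] E} (hB : Dense (B.domain : Set E))
    (h : B ≤ B†) : B.IsFormalAdjoint B := by
  intro x y
  rw [h.2 (x := x) (y := ⟨x, h.1 x.2⟩) rfl]
  exact LinearPMap.adjoint_isFormalAdjoint hB _ y

end Adjoints

/-- If the pair `(Γ₀, Γ₁)` is surjective, then so is `(Γ₀ ⊗ I, Γ₁ ⊗ I)`, since `(Γ₀, Γ₁)` has a
bounded right inverse. -/
theorem exists_tensorMap_eq {E G K : Type*} [NormedAddCommGroup E] [InnerProductSpace ℂ E]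
    [CompleteSpace E] [NormedAddCommGroup G] [InnerProductSpace ℂ G] [CompleteSpace G]
    [NormedAddCommGroup K] [InnerProductSpace ℂ K] {Γ₀ Γ₁ : E →L[ℂ] G}
    (h : ∀ x y, ∃ u, Γ₀ u = x ∧ Γ₁ u = y) (x y : HTensor G K) :
    ∃ u, tensorMap Γ₀ (ContinuousLinearMap.id ℂ K) u = x ∧
      tensorMap Γ₁ (ContinuousLinearMap.id ℂ K) u = y := by
  set F : E →L[ℂ] WithLp 2 (G × G) := (inlL G).comp Γ₀ + (inrL G).comp Γ₁
  have h0 : (WithLp.fstL 2 ℂ G G).comp F = Γ₀ := by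
    ext u; exact add_zero (Γ₀ u)
  have h1 : (WithLp.sndL 2 ℂ G G).comp F = Γ₁ := by
    ext u; exact zero_add (Γ₁ u)
  have hF : Function.Surjective F := fun p => by
    obtain ⟨u, hu0, hu1⟩ := h p.fst p.snd
    refine ⟨u, (WithLp.ofLp_injective 2) (Prod.ext ?_ ?_)⟩
    · exact (congrArg (fun L => L u) h0).trans hu0
    · exact (congrArg (fun L => L u) h1).trans hu1
  obtain ⟨R, hR⟩ := exists_rightInverse_of_surjective F hF
  have r0 : Γ₀.comp R = WithLp.fstL 2 ℂ G G := by
    rw [← h0, ContinuousLinearMap.comp_assoc, hR, ContinuousLinearMap.comp_id]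
  have r1 : Γ₁.comp R = WithLp.sndL 2 ℂ G G := by
    rw [← h1, ContinuousLinearMap.comp_assoc, hR, ContinuousLinearMap.comp_id]
  have a0 : (WithLp.fstL 2 ℂ G G).comp (inlL G) = ContinuousLinearMap.id ℂ G := rfl
  have b0 : (WithLp.fstL 2 ℂ G G).comp (inrL G) = 0 := rfl
  have a1 : (WithLp.sndL 2 ℂ G G).comp (inrL G) = ContinuousLinearMap.id ℂ G := rfl
  have b1 : (WithLp.sndL 2 ℂ G G).comp (inlL G) = 0 := rfl
  refine ⟨tensorMap R (ContinuousLinearMap.id ℂ K)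
    (tensorMap (inlL G) (ContinuousLinearMap.id ℂ K) x +
      tensorMap (inrL G) (ContinuousLinearMap.id ℂ K) y), ?_, ?_⟩
  · rw [tensorMap_tensorMap, map_add, tensorMap_tensorMap, tensorMap_tensorMap, r0, a0, b0,
      ContinuousLinearMap.comp_id, ContinuousLinearMap.comp_id, tensorMap_id, tensorMap_zero_left]
    exact add_zero x
  · rw [tensorMap_tensorMap, map_add, tensorMap_tensorMap, tensorMap_tensorMap, r1, a1, b1,
      ContinuousLinearMap.comp_id, ContinuousLinearMap.comp_id, tensorMap_id, tensorMap_zero_left]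
    exact zero_add y

namespace BoundaryTriplet

section TensorSum

variable {H G K : Type*}
  [NormedAddCommGroup H] [InnerProductSpace ℂ H] [CompleteSpace H]
  [NormedAddCommGroup G] [InnerProductSpace ℂ G]
  [NormedAddCommGroup K] [InnerProductSpace ℂ K] [CompleteSpace K]
  {A : H →ₗ.[ℂ] H} {T : K →L[ℂ] K}

theorem algTensorSum_le_adjoint (PA : BoundaryTriplet A G) (hT : IsSelfAdjoint T) :
    algTensorSum A T ≤ (algTensorSum A T)† := by
  refine LinearPMap.le_of_le_graph (graph_algTensorSum_le fun f y => ?_)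
  rw [mem_graph_adjoint_algTensorSum PA.dense_domain hT]
  set f' : A†.domain := ⟨f, PA.le_adjoint.1 f.2⟩
  have hA : A† f' = A f := (PA.le_adjoint.2 (x := f) (y := f') rfl).symm
  refine ⟨htmul (graphMk A† f') y, ?_, ?_⟩
  · rw [sumEmb_htmul, graphEmb_graphMk]
  · rw [sumVal_htmul, graphEmb_graphMk, graphVal_graphMk, hA]

theorem algTensorSum_isClosable (PA : BoundaryTriplet A G) (hT : IsSelfAdjoint T) :
    (algTensorSum A T).IsClosable :=
  (LinearPMap.adjoint_isClosed (dense_domain_algTensorSum PA.dense_domain)).isClosable.leIsClosable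
    (PA.algTensorSum_le_adjoint hT)

theorem tensorSum_isClosed (PA : BoundaryTriplet A G) (hT : IsSelfAdjoint T) :
    (tensorSum A T).IsClosed :=
  (PA.algTensorSum_isClosable hT).closure_isClosed

theorem adjoint_tensorSum (PA : BoundaryTriplet A G) (hT : IsSelfAdjoint T) :
    (tensorSum A T)† = (algTensorSum A T)† :=
  adjoint_closure (dense_domain_algTensorSum PA.dense_domain) (PA.algTensorSum_isClosable hT)

theorem tensorSum_isFormalAdjoint (PA : BoundaryTriplet A G) (hT : IsSelfAdjoint T) :
    (tensorSum A T).IsFormalAdjoint (tensorSum A T) := by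
  refine isFormalAdjoint_of_le_adjoint (dense_domain_tensorSum PA.dense_domain) ?_
  rw [PA.adjoint_tensorSum hT]
  refine LinearPMap.le_of_le_graph ?_
  rw [tensorSum, ← (PA.algTensorSum_isClosable hT).graph_closure_eq_closure_graph]
  exact Submodule.topologicalClosure_minimal _
    (LinearPMap.le_graph_of_le (PA.algTensorSum_le_adjoint hT))
    (LinearPMap.adjoint_isClosed (dense_domain_algTensorSum PA.dense_domain))

theorem mem_graph_adjoint_tensorSum (PA : BoundaryTriplet A G) (hT : IsSelfAdjoint T)
    (x y : HTensor H K) :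
    (x, y) ∈ (tensorSum A T)†.graph ↔ ∃ u, sumEmb A K u = x ∧ sumVal A T u = y := by
  rw [PA.adjoint_tensorSum hT, mem_graph_adjoint_algTensorSum PA.dense_domain hT]

theorem sumEmb_injective (PA : BoundaryTriplet A G) : Function.Injective (sumEmb A K) := by
  have := PA.completeSpace_graphSpace
  exact tensorMap_injective (graphEmb_injective _)

/-- The linear isomorphism from `dom A† ⊗ K`, with the graph norm on `dom A†`, onto the domain of
the adjoint of `A ⊗ I + I ⊗ T`. -/
noncomputable def sumDomainEquiv (PA : BoundaryTriplet A G) (hT : IsSelfAdjoint T) :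
    HTensor (graphSpace A†) K ≃ₗ[ℂ] (tensorSum A T)†.domain :=
  LinearEquiv.ofBijective ((sumEmb A K).toLinearMap.codRestrict _ fun u =>
      LinearPMap.mem_domain_of_mem_graph
        ((PA.mem_graph_adjoint_tensorSum hT _ _).2 ⟨u, rfl, rfl⟩))
    ⟨fun u v h => PA.sumEmb_injective (congrArg Subtype.val h), fun x => by
      obtain ⟨u, hu, -⟩ := (PA.mem_graph_adjoint_tensorSum hT _ _).1
        ((tensorSum A T)†.mem_graph x)
      exact ⟨u, Subtype.ext hu⟩⟩

theorem coe_sumDomainEquiv (PA : BoundaryTriplet A G) (hT : IsSelfAdjoint T)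
    (u : HTensor (graphSpace A†) K) :
    (PA.sumDomainEquiv hT u : HTensor H K) = sumEmb A K u := rfl

theorem adjoint_sumDomainEquiv (PA : BoundaryTriplet A G) (hT : IsSelfAdjoint T)
    (u : HTensor (graphSpace A†) K) :
    (tensorSum A T)† (PA.sumDomainEquiv hT u) = sumVal A T u :=
  LinearPMap.mem_graph_snd_inj _ ((tensorSum A T)†.mem_graph (PA.sumDomainEquiv hT u))
    ((PA.mem_graph_adjoint_tensorSum hT _ _).2 ⟨u, rfl, rfl⟩) rfl

/-- The operator `Γ ⊗ I` on `dom A† ⊗ K`. -/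
noncomputable abbrev tensorId (L : graphSpace A† →L[ℂ] G) (K : Type*) [NormedAddCommGroup K]
    [InnerProductSpace ℂ K] : HTensor (graphSpace A†) K →L[ℂ] HTensor G K :=
  tensorMap L (ContinuousLinearMap.id ℂ K)

/-- A bounded operator on `dom A†` with the graph norm, tensored with the identity, as an operator
on the domain of the adjoint of `A ⊗ I + I ⊗ T`. -/
noncomputable def liftBoundary (PA : BoundaryTriplet A G) (hT : IsSelfAdjoint T)
    (L : graphSpace A† →L[ℂ] G) :
    (tensorSum A T)†.domain →ₗ[ℂ] HTensor G K :=
  (tensorId L K).toLinearMap ∘ₗ (PA.sumDomainEquiv hT).symm.toLinearMap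

theorem liftBoundary_apply (PA : BoundaryTriplet A G) (hT : IsSelfAdjoint T)
    (L : graphSpace A† →L[ℂ] G) (u : HTensor (graphSpace A†) K) :
    PA.liftBoundary hT L (PA.sumDomainEquiv hT u) = tensorId L K u := by
  simp [liftBoundary]

theorem mk_liftBoundary (PA : BoundaryTriplet A G) (hT : IsSelfAdjoint T)
    (L : graphSpace A† →L[ℂ] G) :
    (⟨(tensorSum A T)†.domain, PA.liftBoundary hT L⟩ : HTensor H K →ₗ.[ℂ] HTensor G K) =
      tensorBoundary A L K := by
  refine LinearPMap.eq_of_eq_graph ?_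
  rw [tensorBoundary, Submodule.toLinearPMap_graph_eq]
  · ext ⟨x, y⟩
    rw [LinearPMap.mem_graph_iff]
    constructor
    · rintro ⟨w, hw, hw'⟩
      obtain ⟨u, rfl⟩ := (PA.sumDomainEquiv hT).surjective w
      exact ⟨u, Prod.ext hw ((PA.liftBoundary_apply hT L u).symm.trans hw')⟩
    · rintro ⟨u, hu⟩
      exact ⟨PA.sumDomainEquiv hT u, congrArg Prod.fst hu,
        (PA.liftBoundary_apply hT L u).trans (congrArg Prod.snd hu)⟩
  · rintro _ ⟨u, rfl⟩ hx
    have : u = 0 := PA.sumEmb_injective (hx.trans (map_zero _).symm)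
    rw [this]
    exact map_zero (tensorId L K)

theorem exists_eq_graphMk_sumDomainEquiv (PA : BoundaryTriplet A G) (hT : IsSelfAdjoint T)
    (v : graphSpace (tensorSum A T)†) :
    ∃ u, v = graphMk _ (PA.sumDomainEquiv hT u) := by
  obtain ⟨u, hu⟩ := (PA.sumDomainEquiv hT).surjective (graphToDomain _ v)
  refine ⟨u, graphEmb_injective _ ?_⟩
  rw [graphEmb_graphMk, hu]; rfl

end TensorSum

section TensorTriplet

variable {H G K : Type*}
  [NormedAddCommGroup H] [InnerProductSpace ℂ H] [CompleteSpace H]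
  [NormedAddCommGroup G] [InnerProductSpace ℂ G] [CompleteSpace G]
  [NormedAddCommGroup K] [InnerProductSpace ℂ K] [CompleteSpace K]
  {A : H →ₗ.[ℂ] H} (PA : BoundaryTriplet A G) {T : K →L[ℂ] K} (hT : IsSelfAdjoint T)

/-- The tensor product of a boundary triplet with the identity, a boundary triplet for
`A ⊗ I + I ⊗ T`. -/
noncomputable def tensorTriplet : BoundaryTriplet (tensorSum A T) (HTensor G K) where
  dense_domain := dense_domain_tensorSum PA.dense_domain
  symmetric := PA.tensorSum_isFormalAdjoint hT
  Γ₀ := PA.liftBoundary hT PA.hatΓ₀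
  Γ₁ := PA.liftBoundary hT PA.hatΓ₁
  green f g := by
    obtain ⟨u, rfl⟩ := (PA.sumDomainEquiv hT).surjective f
    obtain ⟨v, rfl⟩ := (PA.sumDomainEquiv hT).surjective g
    rw [adjoint_sumDomainEquiv, adjoint_sumDomainEquiv, liftBoundary_apply, liftBoundary_apply,
      liftBoundary_apply, liftBoundary_apply]
    exact green_tensorMap PA.green_hat (ContinuousLinearMap.isSelfAdjoint_iff_isSymmetric.1 hT)
      (sumEmb_htmul A) (sumVal_htmul A T) (fun a k => tensorMap_htmul _ _ a k)
      (fun a k => tensorMap_htmul _ _ a k) u v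
  surjective x y := by
    have := PA.completeSpace_graphSpace
    obtain ⟨u, hu0, hu1⟩ := exists_tensorMap_eq (K := K) PA.hat_surjective x y
    exact ⟨PA.sumDomainEquiv hT u, (PA.liftBoundary_apply hT _ u).trans hu0,
      (PA.liftBoundary_apply hT _ u).trans hu1⟩

theorem mem_graph_ext₀ {x y : H} :
    (x, y) ∈ PA.ext₀.graph ↔ ∃ u, PA.hatΓ₀ u = 0 ∧ graphEmb A† u = x ∧ graphVal A† u = y := by
  constructor
  · intro h
    obtain ⟨⟨f, ⟨g, hg, hgf⟩, hf'⟩, rfl, rfl⟩ := (LinearPMap.mem_graph_iff _).1 h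
    exact ⟨graphMk A† ⟨f, hf'⟩, by
      rw [show (⟨f, hf'⟩ : A†.domain) = g from Subtype.ext hgf.symm]; exact hg, rfl, rfl⟩
  · rintro ⟨u, hu, rfl, rfl⟩
    refine (LinearPMap.mem_graph_iff _).2
      ⟨⟨graphEmb A† u, ⟨graphToDomain A† u, hu, rfl⟩, graphEmb_mem _ u⟩, rfl, ?_⟩
    rw [← apply_graphToDomain]
    exact LinearPMap.domRestrict_apply rfl

/-- The operator `A₀` is closed. -/
theorem ext₀_isClosed : PA.ext₀.IsClosed := by
  have := PA.completeSpace_graphSpace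
  have h1 : IsComplete ((↑) '' (LinearMap.ker PA.hatΓ₀.toLinearMap : Set (graphSpace A†)) :
      Set (WithLp 2 (H × H))) :=
    (isComplete_image_iff isometry_subtype_coe.isUniformInducing).2
      PA.hatΓ₀.isClosed_ker.isComplete
  have h2 : (PA.ext₀.graph : Set (H × H)) = WithLp.toLp 2 ⁻¹'
      ((↑) '' (LinearMap.ker PA.hatΓ₀.toLinearMap : Set (graphSpace A†))) := by
    ext ⟨x, y⟩
    refine PA.mem_graph_ext₀.trans ⟨?_, ?_⟩
    · rintro ⟨u, hu, rfl, rfl⟩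
      exact ⟨u, hu, rfl⟩
    · rintro ⟨u, hu, hxy⟩
      exact ⟨u, hu, congrArg (fun p => p.fst) hxy, congrArg (fun p => p.snd) hxy⟩
  rw [LinearPMap.IsClosed, h2]
  exact h1.isClosed.preimage (WithLp.prod_continuous_toLp 2 H H)

theorem tensorTriplet_hatΓ₀_graphMk (u : HTensor (graphSpace A†) K) :
    (PA.tensorTriplet hT).hatΓ₀ (graphMk _ (PA.sumDomainEquiv hT u)) = tensorId PA.hatΓ₀ K u :=
  PA.liftBoundary_apply hT PA.hatΓ₀ u

theorem tensorTriplet_hatΓ₁_graphMk (u : HTensor (graphSpace A†) K) :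
    (PA.tensorTriplet hT).hatΓ₁ (graphMk _ (PA.sumDomainEquiv hT u)) = tensorId PA.hatΓ₁ K u :=
  PA.liftBoundary_apply hT PA.hatΓ₁ u

theorem mem_graph_tensorTriplet_ext₀ {x y : HTensor H K} :
    (x, y) ∈ (PA.tensorTriplet hT).ext₀.graph ↔
      ∃ u, tensorId PA.hatΓ₀ K u = 0 ∧ sumEmb A K u = x ∧ sumVal A T u = y := by
  rw [mem_graph_ext₀]
  constructor
  · rintro ⟨v, hv, hx, hy⟩
    obtain ⟨u, rfl⟩ := PA.exists_eq_graphMk_sumDomainEquiv hT v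
    rw [tensorTriplet_hatΓ₀_graphMk] at hv
    rw [graphVal_graphMk, adjoint_sumDomainEquiv] at hy
    exact ⟨u, hv, hx, hy⟩
  · rintro ⟨u, hu, rfl, rfl⟩
    exact ⟨graphMk _ (PA.sumDomainEquiv hT u), by rwa [tensorTriplet_hatΓ₀_graphMk], rfl,
      by rw [graphVal_graphMk, adjoint_sumDomainEquiv]⟩

/-- The distinguished extension: `S₀ = A₀ ⊗ I + I ⊗ T`. The kernel of `Γ₀ ⊗ I` is the closure of
the algebraic tensor product of `ker Γ₀` with `K`, because `ker Γ₀` is the range of a bounded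
projection in the graph space. -/
theorem tensorTriplet_ext₀ : (PA.tensorTriplet hT).ext₀ = tensorSum PA.ext₀ T := by
  have hle : algTensorSum PA.ext₀ T ≤ (PA.tensorTriplet hT).ext₀ := by
    refine LinearPMap.le_of_le_graph (graph_algTensorSum_le fun f y => ?_)
    obtain ⟨u, hu, hx, hy⟩ := PA.mem_graph_ext₀.1 (PA.ext₀.mem_graph f)
    rw [mem_graph_tensorTriplet_ext₀]
    refine ⟨htmul u y, ?_, ?_, ?_⟩
    · rw [tensorMap_htmul, hu]; simpa using htmul_smul_left 0 (0 : G) y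
    · rw [sumEmb_htmul, hx]
    · rw [sumVal_htmul, hx, hy]
  have hcl := (PA.tensorTriplet hT).ext₀_isClosed
  have hcb : (algTensorSum PA.ext₀ T).IsClosable := hcl.isClosable.leIsClosable hle
  refine LinearPMap.eq_of_eq_graph (le_antisymm ?_ ?_)
  · rintro ⟨x, y⟩ hxy
    obtain ⟨u, hu, rfl, rfl⟩ := (PA.mem_graph_tensorTriplet_ext₀ hT).1 hxy
    rw [tensorSum, ← hcb.graph_closure_eq_closure_graph]
    refine mem_of_tensorMap_eq_zero (PA.hatΓ₀_gammaHat (z := Complex.I) (by simp))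
      ((sumEmb A K).prod (sumVal A T)) (Submodule.isClosed_topologicalClosure _)
      (fun w hw k => Submodule.le_topologicalClosure _ ?_) hu
    obtain ⟨f, hf, hf'⟩ := (LinearPMap.mem_graph_iff _).1
      (PA.mem_graph_ext₀.2 ⟨w, hw, rfl, rfl⟩)
    have hmem := mem_graph_algTensorSum PA.ext₀ T f k
    simp only at hf hf'
    rw [hf, hf'] at hmem
    change (sumEmb A K (htmul w k), sumVal A T (htmul w k)) ∈ _
    rw [sumEmb_htmul, sumVal_htmul]
    exact hmem
  · rw [tensorSum, ← hcb.graph_closure_eq_closure_graph]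
    exact Submodule.topologicalClosure_minimal _ (LinearPMap.le_graph_of_le hle) hcl

end TensorTriplet

end BoundaryTriplet

/-! ### Orthogonal sums of operators -/

section OrthogonalSums

theorem norm_sum_sq_of_orthogonal {ι E : Type*} [Fintype ι] [NormedAddCommGroup E]
    [InnerProductSpace ℂ E] {v : ι → E} (h : ∀ i j, i ≠ j → ⟪v i, v j⟫_ℂ = 0) :
    ‖∑ i, v i‖ ^ 2 = ∑ i, ‖v i‖ ^ 2 := by
  have h1 : ⟪∑ i, v i, ∑ i, v i⟫_ℂ = ∑ i, ⟪v i, v i⟫_ℂ := by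
    rw [sum_inner]
    refine Finset.sum_congr rfl fun i _ => ?_
    rw [inner_sum]
    exact Finset.sum_eq_single i (fun j _ hj => h i j hj.symm) (by simp)
  simp only [inner_self_eq_norm_sq_to_K] at h1
  exact_mod_cast h1

variable {ι E F K : Type*} [Fintype ι]
  [NormedAddCommGroup E] [InnerProductSpace ℂ E] [CompleteSpace E]
  [NormedAddCommGroup F] [InnerProductSpace ℂ F] [CompleteSpace F]
  [NormedAddCommGroup K] [InnerProductSpace ℂ K] [CompleteSpace K]

theorem adjoint_tensorMap_starProjection (N : Submodule ℂ K) [N.HasOrthogonalProjection] :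
    ContinuousLinearMap.adjoint (tensorMap (ContinuousLinearMap.id ℂ E) N.starProjection) =
      tensorMap (ContinuousLinearMap.id ℂ E) N.starProjection := by
  rw [adjoint_tensorMap, ContinuousLinearMap.adjoint_id,
    (isSelfAdjoint_starProjection N).adjoint_eq]

theorem inner_tensorMap_starProjection_eq_zero {N N' : Submodule ℂ K}
    [N.HasOrthogonalProjection] [N'.HasOrthogonalProjection] (h : N ⟂ N') (u v : HTensor E K) :
    ⟪tensorMap (ContinuousLinearMap.id ℂ E) N.starProjection u,
      tensorMap (ContinuousLinearMap.id ℂ E) N'.starProjection v⟫_ℂ = 0 := by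
  rw [← ContinuousLinearMap.adjoint_inner_right, adjoint_tensorMap_starProjection,
    tensorMap_tensorMap, h.starProjection_comp_starProjection, tensorMap_zero_right]
  exact inner_zero_right u

variable {M : ι → Submodule ℂ K} [∀ i, (M i).HasOrthogonalProjection]

theorem norm_sq_eq_sum_tensorMap_starProjection (hM : ∀ i j, i ≠ j → M i ⟂ M j)
    (hsum : ∑ i, (M i).starProjection = ContinuousLinearMap.id ℂ K) (u : HTensor E K) :
    ‖u‖ ^ 2 =
      ∑ i, ‖tensorMap (ContinuousLinearMap.id ℂ E) (M i).starProjection u‖ ^ 2 := by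
  rw [← norm_sum_sq_of_orthogonal fun i j hij =>
    inner_tensorMap_starProjection_eq_zero (hM i j hij) u u]
  have h1 := tensorMap_sum_right Finset.univ (ContinuousLinearMap.id ℂ E)
    fun i => (M i).starProjection
  rw [hsum, tensorMap_id] at h1
  have h2 := congrArg (fun L => L u) h1
  rw [sum_apply, ContinuousLinearMap.id_apply] at h2
  rw [← h2]

/-- A sum `∑ X i ⊗ Y i P i`, where the `P i` are orthogonal projections onto pairwise orthogonal
subspaces that add up to the identity, and `Y i` commutes with `P i`, is an orthogonal sum of
operators. So its norm is bounded by the largest norm of its terms. -/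
theorem norm_sum_tensorMap_le (hM : ∀ i j, i ≠ j → M i ⟂ M j)
    (hsum : ∑ i, (M i).starProjection = ContinuousLinearMap.id ℂ K)
    {X : ι → E →L[ℂ] F} {Y : ι → K →L[ℂ] K}
    (hY : ∀ i x, (M i).starProjection (Y i x) = Y i ((M i).starProjection x))
    {c : ℝ} (hc : 0 ≤ c) (hXY : ∀ i, ‖X i‖ * ‖(Y i).comp (M i).starProjection‖ ≤ c) :
    ‖∑ i, tensorMap (X i) ((Y i).comp (M i).starProjection)‖ ≤ c := by
  have hidem : ∀ i, (M i).starProjection.comp (M i).starProjection = (M i).starProjection :=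
    fun i => (M i).isIdempotentElem_starProjection
  have hY' : ∀ i, (M i).starProjection.comp ((Y i).comp (M i).starProjection) =
      (Y i).comp (M i).starProjection := fun i => by
    refine ContinuousLinearMap.ext fun x => ?_
    change (M i).starProjection (Y i _) = Y i _
    rw [hY]
    exact congrArg (Y i) (congrArg (fun L => L x) (hidem i))
  refine ContinuousLinearMap.opNorm_le_bound _ hc fun u => ?_
  have hv1 : ∀ i, tensorMap (X i) ((Y i).comp (M i).starProjection) u =
      tensorMap (ContinuousLinearMap.id ℂ F) (M i).starProjection
        (tensorMap (X i) ((Y i).comp (M i).starProjection) u) := fun i => by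
    rw [tensorMap_tensorMap, ContinuousLinearMap.id_comp, hY']
  have hv2 : ∀ i, ‖tensorMap (X i) ((Y i).comp (M i).starProjection) u‖ ≤
      c * ‖tensorMap (ContinuousLinearMap.id ℂ E) (M i).starProjection u‖ := fun i => by
    have : tensorMap (X i) ((Y i).comp (M i).starProjection) u =
        tensorMap (X i) ((Y i).comp (M i).starProjection)
          (tensorMap (ContinuousLinearMap.id ℂ E) (M i).starProjection u) := by
      rw [tensorMap_tensorMap, ContinuousLinearMap.comp_id, ContinuousLinearMap.comp_assoc, hidem]
    rw [this]
    exact (ContinuousLinearMap.le_opNorm _ _).trans (mul_le_mul_of_nonneg_right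
      ((norm_tensorMap_le _ _).trans (hXY i)) (norm_nonneg _))
  rw [sum_apply]
  have e1 := norm_sum_sq_of_orthogonal
    (v := fun i => tensorMap (X i) ((Y i).comp (M i).starProjection) u) fun i j hij => by
      rw [hv1 i, hv1 j]
      exact inner_tensorMap_starProjection_eq_zero (hM i j hij) _ _
  have e3 : ‖∑ i, tensorMap (X i) ((Y i).comp (M i).starProjection) u‖ ^ 2 ≤ (c * ‖u‖) ^ 2 := by
    rw [e1, mul_pow, norm_sq_eq_sum_tensorMap_starProjection hM hsum u, Finset.mul_sum]
    refine Finset.sum_le_sum fun i _ => ?_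
    rw [← mul_pow]
    exact pow_le_pow_left₀ (norm_nonneg _) (hv2 i) 2
  exact le_of_sq_le_sq e3 (mul_nonneg hc (norm_nonneg u))

end OrthogonalSums

/-! ### Riemann sums -/

section SpectralSums

variable {E F K : Type*}
  [NormedAddCommGroup E] [InnerProductSpace ℂ E] [CompleteSpace E]
  [NormedAddCommGroup F] [InnerProductSpace ℂ F] [CompleteSpace F]
  [NormedAddCommGroup K] [InnerProductSpace ℂ K] [CompleteSpace K]
  {T : K →L[ℂ] K} (P : TaggedPartition (sInf (spectrum ℝ T)) (sSup (spectrum ℝ T)))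

/-- The error made when `g(T)` is replaced by `g` evaluated at the tags of a partition is bounded
by the oscillation of `g` on the scale of the mesh. -/
theorem norm_sum_tensorMap_spectralMeasure_le (hT : IsSelfAdjoint T) {g : ℂ → ℂ}
    (hg : ContinuousOn g (spectrum ℂ T)) {d r C : ℝ} (hr : 0 < r) (hC : 0 ≤ C) (hP : P.MeshLt d)
    (h : ∀ i, ∀ t : ℝ, |t - P.tag i| < d → ‖g t - g (P.tag i)‖ ≤ r)
    {X : Fin (P.n + 1) → E →L[ℂ] F} (hX : ∀ i, ‖X i‖ ≤ C) :
    ‖∑ i, tensorMap (X i) ((cfc g T - g (P.tag i) • ContinuousLinearMap.id ℂ K).comp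
      (spectralMeasure T (P.cell i)))‖ ≤ C * r := by
  refine norm_sum_tensorMap_le (fun i j hij => spectralSubspace_cell_isOrtho P hij)
    (sum_spectralMeasure_cell P hT) (fun i x => ?_) (by positivity) fun i => ?_
  · have hcomm : Commute T (spectralSubspace T (P.cell i)).starProjection := by
      refine ContinuousLinearMap.ext fun y => ?_
      exact (starProjection_comm_of_invariant hT
        (fun x hx => apply_mem_spectralSubspace hT hx) y).symm
    have := congrArg (fun L => L x) (hT.commute_cfc hcomm g).eq
    change (spectralSubspace T (P.cell i)).starProjection (cfc g T x - g (P.tag i) • x) =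
      cfc g T ((spectralSubspace T (P.cell i)).starProjection x) -
        g (P.tag i) • (spectralSubspace T (P.cell i)).starProjection x
    rw [map_sub, map_smul]
    congr 1
    exact this.symm
  · refine mul_le_mul (hX i) (ContinuousLinearMap.opNorm_le_bound _ hr.le fun y => ?_)
      (norm_nonneg _) hC
    refine (norm_cfc_cell_le P hT hg hr hP i (h i)
      (Submodule.starProjection_apply_mem _ y)).trans ?_
    exact mul_le_mul_of_nonneg_left (Submodule.norm_starProjection_apply_le _ y) hr.le

end SpectralSums

namespace BoundaryTriplet

variable {H G K : Type*}
  [NormedAddCommGroup H] [InnerProductSpace ℂ H] [CompleteSpace H]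
  [NormedAddCommGroup G] [InnerProductSpace ℂ G] [CompleteSpace G]
  [NormedAddCommGroup K] [InnerProductSpace ℂ K] [CompleteSpace K]
  {A : H →ₗ.[ℂ] H} (PA : BoundaryTriplet A G) {T : K →L[ℂ] K} (hT : IsSelfAdjoint T)

/-- The `γ`-field is bounded along a compact horizontal segment off the real axis. -/
theorem exists_norm_gammaField_le {z : ℂ} (hz : z.im ≠ 0) (a b : ℝ) :
    ∃ C, 0 ≤ C ∧ ∀ t ∈ Set.Icc a b, ‖PA.gammaField (z - (t : ℂ))‖ ≤ C := by
  have hc : Continuous fun t : ℝ => (1 + resBound (z - (t : ℂ)) * ‖Complex.I - (z - (t : ℂ))‖) *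
      ‖PA.gammaHat Complex.I‖ := by
    have : Continuous fun t : ℝ => resBound (z - (t : ℂ)) := by
      unfold resBound
      refine continuous_const.add (Continuous.div (by fun_prop) (by fun_prop) fun t => ?_)
      simpa using hz
    fun_prop
  obtain ⟨C, hC⟩ := isCompact_Icc.exists_bound_of_continuousOn (s := Set.Icc a b) hc.continuousOn
  refine ⟨max C 0, le_max_right _ _, fun t ht => ?_⟩
  have hz' : (z - (t : ℂ)).im ≠ 0 := by simpa using hz
  refine le_trans ?_ (((le_abs_self _).trans (hC t ht)).trans (le_max_left _ _))
  refine le_trans ?_ (PA.norm_gammaHat_le hz')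
  refine ContinuousLinearMap.opNorm_le_bound _ (ContinuousLinearMap.opNorm_nonneg _) fun g => ?_
  exact (norm_graphEmb_le _ _).trans (ContinuousLinearMap.le_opNorm _ _)

/-- The Riemann sum for `∫ (γ(z - λ) ⊗ I) E(dλ)`, with values in `dom A† ⊗ K`. -/
noncomputable def gammaSum (z : ℂ)
    (P : TaggedPartition (sInf (spectrum ℝ T)) (sSup (spectrum ℝ T))) :
    HTensor G K →L[ℂ] HTensor (graphSpace A†) K :=
  ∑ i, tensorMap (PA.gammaHat (z - (P.tag i : ℂ))) (spectralMeasure T (P.cell i))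

variable (P : TaggedPartition (sInf (spectrum ℝ T)) (sSup (spectrum ℝ T)))

theorem tensorMap_gammaSum {F : Type*} [NormedAddCommGroup F] [InnerProductSpace ℂ F]
    (L : graphSpace A† →L[ℂ] F) (B : K →L[ℂ] K) (z : ℂ) (g : HTensor G K) :
    tensorMap L B (PA.gammaSum z P g) =
      ∑ i, tensorMap (L.comp (PA.gammaHat (z - (P.tag i : ℂ))))
        (B.comp (spectralMeasure T (P.cell i))) g := by
  rw [gammaSum, sum_apply, map_sum]
  exact Finset.sum_congr rfl fun i _ => tensorMap_tensorMap _ _ _ _ _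

theorem hatΓ₀_gammaSum (hT : IsSelfAdjoint T) {z : ℂ} (hz : z.im ≠ 0) (g : HTensor G K) :
    tensorId PA.hatΓ₀ K (PA.gammaSum z P g) = g := by
  rw [tensorId, tensorMap_gammaSum]
  have : ∀ i, PA.hatΓ₀.comp (PA.gammaHat (z - (P.tag i : ℂ))) = ContinuousLinearMap.id ℂ G :=
    fun i => ContinuousLinearMap.ext fun x => PA.hatΓ₀_gammaHat (by simpa using hz) x
  simp only [this, ContinuousLinearMap.id_comp]
  rw [← sum_apply, ← tensorMap_sum_right, sum_spectralMeasure_cell P hT,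
    tensorMap_id, ContinuousLinearMap.id_apply]

/-- The Riemann sums solve the equation `(S† - z) u = 0` up to an error of the size of the mesh,
because `A† γ(z - λ) = (z - λ) γ(z - λ)`. -/
theorem sumVal_gammaSum (z : ℂ) (g : HTensor G K) :
    sumVal A T (PA.gammaSum z P g) - z • sumEmb A K (PA.gammaSum z P g) =
      (∑ i, tensorMap (PA.gammaField (z - (P.tag i : ℂ)))
        ((T - (P.tag i : ℂ) • ContinuousLinearMap.id ℂ K).comp
          (spectralMeasure T (P.cell i)))) g := by
  have hV : ∀ i, (graphVal A†).comp (PA.gammaHat (z - (P.tag i : ℂ))) =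
      (z - (P.tag i : ℂ)) • PA.gammaField (z - (P.tag i : ℂ)) := fun i =>
    ContinuousLinearMap.ext fun x => sub_eq_zero.1 (PA.graphSub_gammaHat (z - (P.tag i : ℂ)) x)
  have hJ : ∀ i, (graphEmb A†).comp (PA.gammaHat (z - (P.tag i : ℂ))) =
      PA.gammaField (z - (P.tag i : ℂ)) := fun i => rfl
  have e : sumVal A T (PA.gammaSum z P g) =
      tensorMap (graphVal A†) (ContinuousLinearMap.id ℂ K) (PA.gammaSum z P g) +
        tensorMap (graphEmb A†) T (PA.gammaSum z P g) := rfl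
  rw [e, sumEmb, tensorMap_gammaSum, tensorMap_gammaSum, tensorMap_gammaSum, Finset.smul_sum,
    ← Finset.sum_add_distrib, ← Finset.sum_sub_distrib, sum_apply]
  refine Finset.sum_congr rfl fun i _ => ?_
  rw [hV, hJ, ContinuousLinearMap.id_comp, ContinuousLinearMap.sub_comp,
    ContinuousLinearMap.smul_comp, ContinuousLinearMap.id_comp, tensorMap_sub_right,
    tensorMap_smul_left, tensorMap_smul_right]
  simp only [sub_apply, smul_apply, sub_smul]
  abel

/-- The distance in the graph norm between a Riemann sum and the `γ`-field of the tensor triplet: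
both have the same value under `Γ₀ ⊗ I`, and the Riemann sum is an approximate solution. -/
theorem norm_gammaSum_sub_le {z : ℂ} (hz : z.im ≠ 0) {C d : ℝ} (hC : 0 ≤ C) (hd : 0 < d)
    (hCb : ∀ t ∈ Set.Icc (sInf (spectrum ℝ T)) (sSup (spectrum ℝ T)),
      ‖PA.gammaField (z - (t : ℂ))‖ ≤ C) (hP : P.MeshLt d) (g : HTensor G K) :
    ‖graphMk _ (PA.sumDomainEquiv hT (PA.gammaSum z P g)) - (PA.tensorTriplet hT).gammaHat z g‖ ≤
      resBound z * (C * d) * ‖g‖ := by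
  have h := (PA.tensorTriplet hT).norm_sub_gammaHat_le hz
    (graphMk _ (PA.sumDomainEquiv hT (PA.gammaSum z P g)))
  rw [tensorTriplet_hatΓ₀_graphMk, hatΓ₀_gammaSum PA P hT hz, graphSub_apply, graphVal_graphMk,
    adjoint_sumDomainEquiv, graphEmb_graphMk, coe_sumDomainEquiv, sumVal_gammaSum] at h
  refine h.trans ?_
  rw [mul_assoc]
  refine mul_le_mul_of_nonneg_left ?_ (resBound_pos z).le
  refine (ContinuousLinearMap.le_opNorm _ _).trans (mul_le_mul_of_nonneg_right ?_ (norm_nonneg _))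
  have hN : IsStarNormal T := hT.isStarNormal
  have := norm_sum_tensorMap_spectralMeasure_le P hT (g := id) continuousOn_id hd hC hP
    (fun i t ht => by
      simp only [id]
      rw [← Complex.ofReal_sub, Complex.norm_real]
      exact ht.le)
    (X := fun i => PA.gammaField (z - (P.tag i : ℂ))) (fun i => hCb _ (P.tag_mem_Icc i))
  rw [cfc_id ℂ T] at this
  exact this

/-- The Riemann sums approximate the `γ`-field of the tensor triplet in the graph norm, uniformly on
the unit ball. The factor `D` is the norm of a bounded operator to be applied to them. -/
theorem exists_mesh {z : ℂ} (hz : z.im ≠ 0) (D : ℝ) (hD : 0 ≤ D) {ε : ℝ} (hε : 0 < ε) :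
    ∃ d > 0, ∀ P : TaggedPartition (sInf (spectrum ℝ T)) (sSup (spectrum ℝ T)), P.MeshLt d →
      ∃ c, D * c < ε ∧ 0 ≤ c ∧ ∀ g, ‖graphMk _ (PA.sumDomainEquiv hT (PA.gammaSum z P g)) -
        (PA.tensorTriplet hT).gammaHat z g‖ ≤ c * ‖g‖ := by
  obtain ⟨C, hC, hCb⟩ := PA.exists_norm_gammaField_le hz (sInf (spectrum ℝ T))
    (sSup (spectrum ℝ T))
  have hr := resBound_pos z
  have hK : 0 ≤ D * (resBound z * C) := by positivity
  have hd : 0 < ε / (D * (resBound z * C) + 1) := by positivity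
  refine ⟨_, hd, fun P hP => ⟨_, ?_, ?_, fun g => PA.norm_gammaSum_sub_le hT P hz hC hd hCb hP g⟩⟩
  · have : D * (resBound z * (C * (ε / (D * (resBound z * C) + 1)))) =
        ε * (D * (resBound z * C)) / (D * (resBound z * C) + 1) := by ring
    rw [this, div_lt_iff₀ (by positivity)]
    nlinarith
  · positivity

theorem hasSpectralIntegral_gammaField {z : ℂ} (hz : z.im ≠ 0) :
    HasSpectralIntegral
      (fun t : ℝ => tensorMap (PA.gammaField (z - t)) (ContinuousLinearMap.id ℂ K))
      (fun δ => tensorMap (ContinuousLinearMap.id ℂ G) (spectralMeasure T δ))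
      (sInf (spectrum ℝ T)) (sSup (spectrum ℝ T)) ((PA.tensorTriplet hT).gammaField z) := by
  intro ε hε
  obtain ⟨d, hd, h⟩ := PA.exists_mesh hT hz 1 zero_le_one hε
  refine ⟨d, hd, fun P hP => ?_⟩
  obtain ⟨c, hcε, hc, hcg⟩ := h P hP
  rw [one_mul] at hcε
  refine lt_of_le_of_lt (ContinuousLinearMap.opNorm_le_bound _ hc fun g => ?_) hcε
  refine le_trans (le_of_eq ?_) ((norm_graphEmb_le _ _).trans (hcg g))
  rw [map_sub, graphEmb_graphMk, coe_sumDomainEquiv, sumEmb, tensorMap_gammaSum]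
  simp only [tensorMap_id_right_comp_id_left, ContinuousLinearMap.id_comp,
    sub_apply, sum_apply]
  rfl

theorem exists_norm_sum_weyl_sub_lt {z : ℂ} (hz : z.im ≠ 0) {ε : ℝ} (hε : 0 < ε) :
    ∃ d > 0, ∀ P : TaggedPartition (sInf (spectrum ℝ T)) (sSup (spectrum ℝ T)), P.MeshLt d →
      ‖∑ i, tensorMap (PA.weyl (z - (P.tag i : ℂ))) (spectralMeasure T (P.cell i)) -
        (PA.tensorTriplet hT).weyl z‖ < ε := by
  obtain ⟨d, hd, h⟩ := PA.exists_mesh hT hz ‖(PA.tensorTriplet hT).hatΓ₁‖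
    (ContinuousLinearMap.opNorm_nonneg _) hε
  refine ⟨d, hd, fun P hP => ?_⟩
  obtain ⟨c, hcε, hc, hcg⟩ := h P hP
  refine lt_of_le_of_lt (ContinuousLinearMap.opNorm_le_bound _ (by positivity) fun g => ?_) hcε
  rw [mul_assoc]
  refine le_trans (le_of_eq ?_) ((ContinuousLinearMap.le_opNorm _ _).trans
    (mul_le_mul_of_nonneg_left (hcg g)
      (ContinuousLinearMap.opNorm_nonneg (PA.tensorTriplet hT).hatΓ₁)))
  rw [map_sub, tensorTriplet_hatΓ₁_graphMk, tensorId, tensorMap_gammaSum]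
  simp only [ContinuousLinearMap.id_comp, sub_apply,
    sum_apply]
  rfl

theorem hasSpectralIntegral_weyl {z : ℂ} (hz : z.im ≠ 0) :
    HasSpectralIntegral
      (fun t : ℝ => tensorMap (PA.weyl (z - t)) (ContinuousLinearMap.id ℂ K))
      (fun δ => tensorMap (ContinuousLinearMap.id ℂ G) (spectralMeasure T δ))
      (sInf (spectrum ℝ T)) (sSup (spectrum ℝ T)) ((PA.tensorTriplet hT).weyl z) := by
  intro ε hε
  obtain ⟨d, hd, h⟩ := PA.exists_norm_sum_weyl_sub_lt hT hz hε
  refine ⟨d, hd, fun P hP => ?_⟩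
  simp only [tensorMap_id_right_comp_id_left]
  exact h P hP

theorem hasSpectralIntegralLeft_weyl {z : ℂ} (hz : z.im ≠ 0) :
    HasSpectralIntegralLeft
      (fun δ => tensorMap (ContinuousLinearMap.id ℂ G) (spectralMeasure T δ))
      (fun t : ℝ => tensorMap (PA.weyl (z - t)) (ContinuousLinearMap.id ℂ K))
      (sInf (spectrum ℝ T)) (sSup (spectrum ℝ T)) ((PA.tensorTriplet hT).weyl z) := by
  intro ε hε
  obtain ⟨d, hd, h⟩ := PA.exists_norm_sum_weyl_sub_lt hT hz hε
  refine ⟨d, hd, fun P hP => ?_⟩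
  simp only [tensorMap_comp, ContinuousLinearMap.comp_id, ContinuousLinearMap.id_comp]
  exact h P hP

/-- For a Weyl function of scalar type, the spectral integral is a function of `T`. -/
theorem weyl_of_isScalarType {m : ℂ → ℂ} (hm : PA.IsScalarType m) {z : ℂ} (hz : z.im ≠ 0) :
    (PA.tensorTriplet hT).weyl z = tensorMap (ContinuousLinearMap.id ℂ G)
      (cfc m (algebraMap ℂ (K →L[ℂ] K) z - T)) := by
  have hN : IsStarNormal T := hT.isStarNormal
  set g : ℂ → ℂ := fun w => m (z - w) with hg
  have hreal : ∀ w ∈ spectrum ℂ T, w.im = 0 := fun w hw => by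
    have := SpectrumRestricts.real_iff.mp hT.spectrumRestricts w hw
    rw [this, Complex.ofReal_im]
  have hmc : ContinuousOn m {w | w.im ≠ 0} := hm.1.1.continuousOn
  have hgc : ContinuousOn g (spectrum ℂ T) :=
    hmc.comp (by fun_prop) fun w hw => by simpa [hreal w hw] using hz
  have hgr : Continuous fun t : ℝ => g t :=
    hmc.comp_continuous (by fun_prop) fun t => by simpa using hz
  have hcfc : cfc m (algebraMap ℂ (K →L[ℂ] K) z - T) = cfc g T := by
    have h1 : algebraMap ℂ (K →L[ℂ] K) z - T = cfc (fun w : ℂ => z - w) T := by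
      rw [cfc_sub (fun _ : ℂ => z) (fun w => w) T continuousOn_const continuousOn_id,
        cfc_const z T, cfc_id' ℂ T]
    rw [h1, ← cfc_comp' m (fun w : ℂ => z - w) T ?_ (by fun_prop)]
    refine hmc.mono ?_
    rintro _ ⟨w, hw, rfl⟩
    simpa [hreal w hw] using hz
  rw [hcfc, ← sub_eq_zero, ← norm_le_zero_iff]
  refine le_of_forall_pos_le_add fun ε hε => ?_
  set a := sInf (spectrum ℝ T) with ha
  set b := sSup (spectrum ℝ T) with hb
  obtain ⟨d₁, hd₁, h₁⟩ := PA.exists_norm_sum_weyl_sub_lt hT hz (half_pos hε)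
  -- The interval is enlarged by one so that it contains all points near the tags.
  have huc : UniformContinuousOn (fun t : ℝ => g t) (Set.Icc (a - 1) (b + 1)) :=
    isCompact_Icc.uniformContinuousOn_of_continuous hgr.continuousOn
  obtain ⟨d₂, hd₂, h₂⟩ := Metric.uniformContinuousOn_iff.1 huc (ε / 2) (half_pos hε)
  have hcpt := isCompact_spectrum_real hT
  obtain ⟨P, hP⟩ := TaggedPartition.exists_meshLt
    (Real.sInf_le_sSup (spectrum ℝ T) hcpt.bddBelow hcpt.bddAbove)
    (lt_min hd₁ (lt_min hd₂ one_pos))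
  have e₁ := h₁ P fun i => (hP i).trans_le (min_le_left _ _)
  have e₂ := norm_sum_tensorMap_spectralMeasure_le P hT hgc (half_pos hε) zero_le_one hP
    (fun i t ht => by
      have ht2 : |t - P.tag i| < d₂ := ht.trans_le ((min_le_right _ _).trans (min_le_left _ _))
      have ht1 : |t - P.tag i| < 1 := ht.trans_le ((min_le_right _ _).trans (min_le_right _ _))
      have htag := P.tag_mem_Icc i
      rw [abs_lt] at ht1
      have := h₂ t ⟨by linarith [htag.1, ht1.1], by linarith [htag.2, ht1.2]⟩ (P.tag i)
        ⟨by linarith [htag.1], by linarith [htag.2]⟩ (by rwa [Real.dist_eq])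
      rw [dist_eq_norm] at this
      exact this.le)
    (X := fun _ => ContinuousLinearMap.id ℂ G) (fun _ => ContinuousLinearMap.norm_id_le)
  rw [one_mul] at e₂
  have e₃ : ∑ i, tensorMap (ContinuousLinearMap.id ℂ G)
      ((cfc g T - g (P.tag i) • ContinuousLinearMap.id ℂ K).comp
        (spectralMeasure T (P.cell i))) =
      tensorMap (ContinuousLinearMap.id ℂ G) (cfc g T) -
        ∑ i, tensorMap (PA.weyl (z - (P.tag i : ℂ))) (spectralMeasure T (P.cell i)) := by
    have hw : ∀ i, tensorMap (PA.weyl (z - (P.tag i : ℂ))) (spectralMeasure T (P.cell i)) =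
        g (P.tag i) • tensorMap (ContinuousLinearMap.id ℂ G) (spectralMeasure T (P.cell i)) := by
      intro i
      rw [hm.2 _ (by simpa using hz), tensorMap_smul_left]
    simp only [hw, ContinuousLinearMap.sub_comp, ContinuousLinearMap.smul_comp,
      ContinuousLinearMap.id_comp, tensorMap_sub_right, tensorMap_smul_right]
    rw [Finset.sum_sub_distrib, ← tensorMap_sum_right, ← ContinuousLinearMap.comp_finsetSum,
      sum_spectralMeasure_cell P hT, ContinuousLinearMap.comp_id]
  rw [e₃] at e₂
  have e₄ := norm_sub_le_norm_sub_add_norm_sub (tensorMap (ContinuousLinearMap.id ℂ G) (cfc g T))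
    (∑ i, tensorMap (PA.weyl (z - (P.tag i : ℂ))) (spectralMeasure T (P.cell i)))
    ((PA.tensorTriplet hT).weyl z)
  rw [norm_sub_rev]
  linarith

end BoundaryTriplet

end TensorTriplet


open TensorTriplet in
theorem theorem4p1 {H G K : Type*}
    [NormedAddCommGroup H] [InnerProductSpace ℂ H] [CompleteSpace H]
    [NormedAddCommGroup G] [InnerProductSpace ℂ G] [CompleteSpace G]
    [NormedAddCommGroup K] [InnerProductSpace ℂ K] [CompleteSpace K]
    (A : H →ₗ.[ℂ] H) (PA : BoundaryTriplet A G) (T : K →L[ℂ] K) (hT : IsSelfAdjoint T) :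
    (tensorSum A T).IsClosed ∧
    ∃ PS : BoundaryTriplet (tensorSum A T) (HTensor G K),
      -- the boundary maps of the triplet for `S†`, and the extension `S₀`
      PS.Γ₀p = BoundaryTriplet.tensorBoundary A PA.hatΓ₀ K ∧
      PS.Γ₁p = BoundaryTriplet.tensorBoundary A PA.hatΓ₁ K ∧
      PS.ext₀ = tensorSum PA.ext₀ T ∧
      -- the `γ`-field, the Weyl function and the defect subspaces
      (∀ z : ℂ, z.im ≠ 0 →
        (PS.restrΓ₀ z).IsInvertible ∧
        HasSpectralIntegral
          (fun t : ℝ => tensorMap (PA.gammaField (z - t)) (ContinuousLinearMap.id ℂ K))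
          (fun δ => tensorMap (ContinuousLinearMap.id ℂ G) (spectralMeasure T δ))
          (sInf (spectrum ℝ T)) (sSup (spectrum ℝ T)) (PS.gammaField z) ∧
        HasSpectralIntegralLeft
          (fun δ => tensorMap (ContinuousLinearMap.id ℂ G) (spectralMeasure T δ))
          (fun t : ℝ => tensorMap (PA.weyl (z - t)) (ContinuousLinearMap.id ℂ K))
          (sInf (spectrum ℝ T)) (sSup (spectrum ℝ T)) (PS.weyl z) ∧
        HasSpectralIntegral
          (fun t : ℝ => tensorMap (PA.weyl (z - t)) (ContinuousLinearMap.id ℂ K))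
          (fun δ => tensorMap (ContinuousLinearMap.id ℂ G) (spectralMeasure T δ))
          (sInf (spectrum ℝ T)) (sSup (spectrum ℝ T)) (PS.weyl z) ∧
        LinearMap.range (PS.gammaField z).toLinearMap = defectSpace (tensorSum A T) z) ∧
      -- Weyl functions of scalar type
      (∀ m : ℂ → ℂ, PA.IsScalarType m → ∀ z : ℂ, z.im ≠ 0 →
        PS.weyl z = tensorMap (ContinuousLinearMap.id ℂ G)
          (cfc m (algebraMap ℂ (K →L[ℂ] K) z - T))) ∧
      -- deficiency indices equal to one
      (Module.finrank ℂ (defectSpace A Complex.I) = 1 →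
        Module.finrank ℂ (defectSpace A (-Complex.I)) = 1 →
        ∃ m : ℂ → ℂ, PA.IsScalarType m ∧ ∀ z : ℂ, z.im ≠ 0 →
          PS.weyl z = tensorMap (ContinuousLinearMap.id ℂ G)
            (cfc m (algebraMap ℂ (K →L[ℂ] K) z - T))) := by
  refine ⟨PA.tensorSum_isClosed hT, PA.tensorTriplet hT, PA.mk_liftBoundary hT PA.hatΓ₀,
    PA.mk_liftBoundary hT PA.hatΓ₁, PA.tensorTriplet_ext₀ hT, fun z hz =>
      ⟨(PA.tensorTriplet hT).restrΓ₀_isInvertible hz, PA.hasSpectralIntegral_gammaField hT hz,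
        PA.hasSpectralIntegralLeft_weyl hT hz, PA.hasSpectralIntegral_weyl hT hz,
        (PA.tensorTriplet hT).range_gammaField hz⟩,
    fun m hm z hz => PA.weyl_of_isScalarType hT hm hz, fun hA _ => ?_⟩
  obtain ⟨m, hm⟩ := PA.exists_isScalarType hA
  exact ⟨m, hm, fun z hz => PA.weyl_of_isScalarType hT hm hz⟩
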